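/- All operads are operads in $\mathbf{Set}$ or in $\mathbf{Cat}$; a $\mathbf{Cat}$-operad has categories $Q(n)$ of $n$-ary operations (its 1-cells and 2-cells), with strictly associative and unital functorial composition; a symmetric ($\mathbf{Cat}$-)operad carries in addition strict, compatible actions of the symmetric groups. Symmetric $\mathbf{Cat}$-operads, their (strict) morphisms, and transformations of these (levelwise natural transformations compatible with composition, identities and the symmetric group actions) form a 2-category $\mathbf{Cat}\text{-}\Sigma\text{-}\mathbf{Operad}$. Write $F^{\rm pl}_\Sigma$ for the free symmetric operad (respectively free symmetric $\mathbf{Cat}$-operad) construction on plain operads (respectively plain $\mathbf{Cat}$-operads), with $(F^{\rm pl}_\Sigma Q)(n)=S_n\times Q(n)$. For a plain operad $P$, let $\epsilon: F_{\rm pl}U^{\rm pl}P\to P$ be the counit of the free/forgetful adjunction between signatures and plain operads. The unbiased weakening $\mathrm{Wk}(P)$ is the plain $\mathbf{Cat}$-operad whose 1-cells are the operations of the free plain operad $F_{\rm pl}U^{\rm pl}P$ and which has exactly one 2-cell $A\to B$ if $\epsilon(A)=\epsilon(B)$ and none otherwise; that is, $F_{\rm pl}U^{\rm pl}P\to\mathrm{Wk}(P)\to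 P$ is the levelwise (bijective on objects)/(full and faithful) factorization of $\epsilon$. For a symmetric operad $R$, the symmetric $\mathbf{Cat}$-operad $\mathrm{Wk}(R)$ is defined in the same way from the counit $F_\Sigma U^\Sigma R\to R$ of the adjunction between signatures and symmetric operads. For a plain or symmetric operad $R$, let $\mathbf{Wk}\text{-}R\text{-}\mathbf{Cat}$ be the 2-category of (strict) algebras for $\mathrm{Wk}(R)$ in small categories, weak morphisms of algebras (functors with natural invertible coherence maps compatible with composition and identities and, in the symmetric case, with the symmetric group actions), and transformations compatible with the coherence maps. Then: 1. For every plain operad $P$, the symmetric $\mathbf{Cat}$-operads $F^{\rm pl}_\Sigma(\mathrm{Wk}(P))$ and $\mathrm{Wk}(F^{\rm pl}_\Sigma P)$ are equivalent in the 2-category $\mathbf{Cat}\text{-}\Sigma\text{-}\mathbf{Operad}$. 2. They are not isomorphic in general: there is a plain operad $P$ for which $F^{\rm pl}_\Sigma(\mathrm{Wk}(P))$ and $\mathrm{Wk}(F^{\rm pl}_\Sigma P)$ are not isomorphic as symmetric $\mathbf{Cat}$-operads. 3. For every plain operad $P$, $\mathbf{Wk}\text{-}P\text{-}\mathbf{Cat}$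 and $\mathbf{Wk}\text{-}(F^{\rm pl}_\Sigma P)\text{-}\mathbf{Cat}$ are equivalent, as 2-categories and hence as categories: there are strict 2-functors in both directions whose composites are isomorphic to the identities by invertible 2-natural transformations. In particular, the unbiased categorification of a strongly regular theory does not change, up to equivalence, when it is treated as a linear theory. -/

import Mathlib

open CategoryTheory

set_option linter.unusedVariables false
set_option linter.checkUnivs false

universe u v w z

/-! ## Blocks and block permutations -/

/-- The order preserving identification of the disjoint union of `n` consecutive blocks, of sizes
`k 0, ..., k (n - 1)`, with `Fin m`, where `m` is the total size. -/
def blockEquiv {n m : ℕ} (k : Fin n → ℕ) (h : ∑ i, k i = m) : (Σ i, Fin (k i)) ≃ Fin m :=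
  finSigmaFinEquiv.trans (finCongr h)

theorem sum_comp_perm {n m : ℕ} {k : Fin n → ℕ} (σ : Equiv.Perm (Fin n)) (h : ∑ i, k i = m) :
    ∑ i, k (σ i) = m :=
  (Equiv.sum_comp σ k).trans h

theorem sum_blocks {n m p : ℕ} {k : Fin n → ℕ} (h : ∑ i, k i = m) {l : Fin m → ℕ}
    (hl : ∑ x, l x = p) : ∑ i, ∑ j, l (blockEquiv k h ⟨i, j⟩) = p := by
  rw [← hl, ← Equiv.sum_comp (blockEquiv k h) l, Fintype.sum_sigma]

/-- The composite `σ ∘ (τ_{σ 1}, ..., τ_{σ n})` in the operad of symmetries: `m` points are divided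
into consecutive blocks of lengths `k (σ 0), ..., k (σ (n - 1))`; the `j`-th block goes to the
`σ j`-th block of the division into blocks of lengths `k 0, ..., k (n - 1)`, and the points of that
block are permuted by `τ (σ j)`. -/
def blockPerm {n m : ℕ} (σ : Equiv.Perm (Fin n)) {k : Fin n → ℕ} (τ : ∀ i, Equiv.Perm (Fin (k i)))
    (h : ∑ i, k i = m) : Equiv.Perm (Fin m) :=
  ((blockEquiv (fun j => k (σ j)) (sum_comp_perm σ h)).symm.trans
    ((Equiv.sigmaCongrRight fun j => τ (σ j)).trans
      (Equiv.sigmaCongrLeft (β := fun i => Fin (k i)) σ))).trans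
    (blockEquiv k h)

theorem blockPerm_blockEquiv {n m : ℕ} (σ : Equiv.Perm (Fin n)) {k : Fin n → ℕ}
    (τ : ∀ i, Equiv.Perm (Fin (k i))) (h : ∑ i, k i = m) (j : Fin n) (a : Fin (k (σ j))) :
    blockPerm σ τ h (blockEquiv (fun j => k (σ j)) (sum_comp_perm σ h) ⟨j, a⟩) =
      blockEquiv k h ⟨σ j, τ (σ j) a⟩ := by
  simp [blockPerm]

theorem blockEquiv_symm_blockPerm {n m : ℕ} (σ : Equiv.Perm (Fin n)) {k : Fin n → ℕ}
    (τ : ∀ i, Equiv.Perm (Fin (k i))) (h : ∑ i, k i = m) (x : Fin m) :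
    (blockEquiv k h).symm (blockPerm σ τ h x) =
      ⟨σ ((blockEquiv (fun j => k (σ j)) (sum_comp_perm σ h)).symm x).1,
        τ _ ((blockEquiv (fun j => k (σ j)) (sum_comp_perm σ h)).symm x).2⟩ := by
  simp [blockPerm]

theorem blockEquiv_val {n m : ℕ} (k : Fin n → ℕ) (h : ∑ i, k i = m) (i : Fin n) (j : Fin (k i)) :
    (blockEquiv k h ⟨i, j⟩ : ℕ) = (∑ a, if a < i then k a else 0) + j := by
  have h1 : (blockEquiv k h ⟨i, j⟩ : ℕ) = ∑ a : Fin i, k (Fin.castLE i.2.le a) + j := by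
    simp [blockEquiv]
  rw [h1, ← Finset.sum_filter]
  congr 1
  refine Finset.sum_bij (fun a _ => Fin.castLE i.2.le a) ?_ ?_ ?_ ?_
  · intro a _
    simp only [Finset.mem_filter, Finset.mem_univ, true_and]
    exact Fin.lt_def.2 a.2
  · intro a _ b _ hab
    simpa using hab
  · intro b hb
    exact ⟨⟨b, Fin.lt_def.1 (Finset.mem_filter.1 hb).2⟩, Finset.mem_univ _, rfl⟩
  · intro a _
    rfl

theorem blockEquiv_lt {n m : ℕ} (k : Fin n → ℕ) (h : ∑ i, k i = m) {i i' : Fin n} (hi : i < i')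
    (j : Fin (k i)) (j' : Fin (k i')) : blockEquiv k h ⟨i, j⟩ < blockEquiv k h ⟨i', j'⟩ := by
  rw [Fin.lt_def, blockEquiv_val, blockEquiv_val]
  have h1 : (∑ a, if a < i then k a else 0) + k i ≤ ∑ a, if a < i' then k a else 0 := by
    rw [← Finset.sum_filter, ← Finset.sum_filter, add_comm,
      ← Finset.sum_insert (by simp : i ∉ Finset.univ.filter fun a => a < i)]
    refine Finset.sum_le_sum_of_subset ?_
    intro a ha
    simp only [Finset.mem_insert, Finset.mem_filter, Finset.mem_univ, true_and] at ha ⊢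
    rcases ha with rfl | ha
    · exact hi
    · exact ha.trans hi
  have := j.2
  omega

theorem blockEquiv_assoc {n m p : ℕ} {k : Fin n → ℕ} (hm : ∑ i, k i = m)
    {l : Fin m → ℕ} (hp : ∑ x, l x = p) {q : Fin n → ℕ}
    (hq : ∀ i, ∑ j, l (blockEquiv k hm ⟨i, j⟩) = q i) (hp' : ∑ i, q i = p)
    (i : Fin n) (a : Fin (k i)) (b : Fin (l (blockEquiv k hm ⟨i, a⟩))) :
    blockEquiv l hp ⟨blockEquiv k hm ⟨i, a⟩, b⟩ =
      blockEquiv q hp' ⟨i, blockEquiv (fun j => l (blockEquiv k hm ⟨i, j⟩)) (hq i) ⟨a, b⟩⟩ := by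
  apply Fin.ext
  rw [blockEquiv_val, blockEquiv_val, blockEquiv_val, ← add_assoc]
  congr 1
  rw [← Equiv.sum_comp (blockEquiv k hm), Fintype.sum_sigma,
    ← Finset.add_sum_erase _ _ (Finset.mem_univ i),
    ← Finset.add_sum_erase _ (fun a => if a < i then q a else 0) (Finset.mem_univ i),
    if_neg (lt_irrefl i), zero_add, add_comm]
  congr 1
  · refine Finset.sum_congr rfl fun i' hi' => ?_
    rcases lt_or_gt_of_ne (Finset.ne_of_mem_erase hi') with h | h
    · rw [if_pos h, ← hq i']
      exact Finset.sum_congr rfl fun j _ => if_pos (blockEquiv_lt k hm h _ _)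
    · rw [if_neg h.not_gt]
      exact Finset.sum_eq_zero fun j _ => if_neg (blockEquiv_lt k hm h _ _).not_gt
  · refine Finset.sum_congr rfl fun j _ => ?_
    have : blockEquiv k hm ⟨i, j⟩ < blockEquiv k hm ⟨i, a⟩ ↔ j < a := by
      rw [Fin.lt_def, blockEquiv_val, blockEquiv_val, Fin.lt_def]
      omega
    simp only [this]

/-! ## Operads in sets -/

/-- A plain operad.  Composition is recorded as a map
`Op n × ∏ i, Op (k i) → Op m` for every `m` with a proof that `∑ i, k i = m`. -/
structure PlainOperad where
  Op : ℕ → Type u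
  one : Op 1
  comp : ∀ {n m : ℕ} {k : Fin n → ℕ}, Op n → (∀ i, Op (k i)) → ∑ i, k i = m → Op m
  one_comp : ∀ {n : ℕ} (f : Op n) (h : ∑ _ : Fin 1, n = n), comp one (fun _ : Fin 1 => f) h = f
  comp_one : ∀ {n : ℕ} (f : Op n) (h : ∑ _ : Fin n, 1 = n), comp f (fun _ => one) h = f
  assoc : ∀ {n m p : ℕ} {k : Fin n → ℕ} {l : ∀ i, Fin (k i) → ℕ} {q : Fin n → ℕ}
    (f : Op n) (g : ∀ i, Op (k i)) (r : ∀ i j, Op (l i j))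
    (hm : ∑ i, k i = m) (hq : ∀ i, ∑ j, l i j = q i) (hp : ∑ i, q i = p)
    (hp' : ∑ x, l ((blockEquiv k hm).symm x).1 ((blockEquiv k hm).symm x).2 = p),
    comp (comp f g hm)
        (fun x => r ((blockEquiv k hm).symm x).1 ((blockEquiv k hm).symm x).2) hp' =
      comp f (fun i => comp (g i) (r i) (hq i)) hp

/-- A symmetric operad: a plain operad with a left action of the symmetric groups that is
compatible with composition.  (In the endomorphism operad of a set, this is the action
`(σ • f) (x₁, ..., xₙ) = f (x_{σ 1}, ..., x_{σ n})`.) -/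
structure SymOperad extends PlainOperad.{u} where
  act : ∀ {n : ℕ}, Equiv.Perm (Fin n) → Op n → Op n
  one_act : ∀ {n : ℕ} (f : Op n), act 1 f = f
  mul_act : ∀ {n : ℕ} (ρ σ : Equiv.Perm (Fin n)) (f : Op n), act (ρ * σ) f = act ρ (act σ f)
  act_comp : ∀ {n m : ℕ} {k : Fin n → ℕ} (σ : Equiv.Perm (Fin n)) (f : Op n)
    (g : ∀ i, Op (k i)) (h : ∑ i, k i = m),
    comp (act σ f) g h =
      act (blockPerm σ (fun _ => 1) h) (comp f (fun i => g (σ i)) (sum_comp_perm σ h))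
  comp_act : ∀ {n m : ℕ} {k : Fin n → ℕ} (f : Op n) (ρ : ∀ i, Equiv.Perm (Fin (k i)))
    (g : ∀ i, Op (k i)) (h : ∑ i, k i = m),
    comp f (fun i => act (ρ i) (g i)) h = act (blockPerm 1 ρ h) (comp f g h)

/-- Morphisms of plain operads. -/
@[ext]
structure PlainOperad.Hom (P Q : PlainOperad.{u}) where
  app : ∀ {n : ℕ}, P.Op n → Q.Op n
  app_one : app P.one = Q.one
  app_comp : ∀ {n m : ℕ} {k : Fin n → ℕ} (f : P.Op n) (g : ∀ i, P.Op (k i)) (h : ∑ i, k i = m),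
    app (P.comp f g h) = Q.comp (app f) (fun i => app (g i)) h

/-- Morphisms of symmetric operads. -/
@[ext]
structure SymOperad.Hom (P Q : SymOperad.{u}) extends
    PlainOperad.Hom P.toPlainOperad Q.toPlainOperad where
  app_act : ∀ {n : ℕ} (σ : Equiv.Perm (Fin n)) (f : P.Op n), app (P.act σ f) = Q.act σ (app f)

namespace PlainOperad

theorem comp_congr (P : PlainOperad.{u}) {n m : ℕ} {k k' : Fin n → ℕ} (f : P.Op n)
    {g : ∀ i, P.Op (k i)} {g' : ∀ i, P.Op (k' i)}
    (hg : ∀ i, (⟨k i, g i⟩ : Σ a, P.Op a) = ⟨k' i, g' i⟩)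
    (h : ∑ i, k i = m) (h' : ∑ i, k' i = m) : P.comp f g h = P.comp f g' h' := by
  obtain rfl : k = k' := funext fun i => congrArg Sigma.fst (hg i)
  obtain rfl : g = g' := funext fun i => by simpa using hg i
  rfl

end PlainOperad

/-! ## The free plain operad on a signature -/

/-- Strongly regular trees labelled by a signature `Φ`: `leaf` is the trivial tree `|`, and
`node φ k t h` is the tree `φ ∘ (t₁, ..., tₙ)`. -/
inductive SRTree (Φ : ℕ → Type u) : ℕ → Type u
  | leaf : SRTree Φ 1
  | node {n m : ℕ} (φ : Φ n) (k : Fin n → ℕ) (t : ∀ i, SRTree Φ (k i)) (h : ∑ i, k i = m) : SRTree Φ m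

namespace SRTree

variable {Φ : ℕ → Type u}

theorem node_congr {n m : ℕ} (φ : Φ n) {k k' : Fin n → ℕ}
    {t : ∀ i, SRTree Φ (k i)} {t' : ∀ i, SRTree Φ (k' i)}
    (ht : ∀ i, (⟨k i, t i⟩ : Σ a, SRTree Φ a) = ⟨k' i, t' i⟩)
    (h : ∑ i, k i = m) (h' : ∑ i, k' i = m) : node φ k t h = node φ k' t' h' := by
  obtain rfl : k = k' := funext fun i => congrArg Sigma.fst (ht i)
  obtain rfl : t = t' := funext fun i => by simpa using ht i
  rfl

/-- Grafting of trees. -/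
def graft : {n : ℕ} → SRTree Φ n → {m : ℕ} → {k : Fin n → ℕ} → (∀ i, SRTree Φ (k i)) →
    ∑ i, k i = m → SRTree Φ m
  | _, leaf, _, k, s, h => ((Fin.sum_univ_one k).symm.trans h) ▸ s 0
  | _, node φ k' t h', _, k, s, h =>
      node φ (fun i => ∑ j, k (blockEquiv k' h' ⟨i, j⟩))
        (fun i => graft (t i) (fun j => s (blockEquiv k' h' ⟨i, j⟩)) rfl) (sum_blocks h' h)

theorem leaf_graft_sigma {m : ℕ} {k : Fin 1 → ℕ} (s : ∀ i, SRTree Φ (k i)) (h : ∑ i, k i = m) :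
    (⟨m, graft leaf s h⟩ : Σ a, SRTree Φ a) = ⟨k 0, s 0⟩ := by
  have h0 : k 0 = m := (Fin.sum_univ_one k).symm.trans h
  subst h0
  simp [graft]

theorem graft_sigma_congr {n m m' : ℕ} {k k' : Fin n → ℕ} (t : SRTree Φ n)
    {s : ∀ i, SRTree Φ (k i)} {s' : ∀ i, SRTree Φ (k' i)}
    (hs : ∀ i, (⟨k i, s i⟩ : Σ a, SRTree Φ a) = ⟨k' i, s' i⟩)
    (h : ∑ i, k i = m) (h' : ∑ i, k' i = m') :
    (⟨m, graft t s h⟩ : Σ a, SRTree Φ a) = ⟨m', graft t s' h'⟩ := by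
  obtain rfl : k = k' := funext fun i => congrArg Sigma.fst (hs i)
  obtain rfl : s = s' := funext fun i => by simpa using hs i
  subst h h'
  rfl

theorem graft_leaf {n : ℕ} (t : SRTree Φ n) : ∀ h : ∑ _ : Fin n, 1 = n,
    graft t (fun _ => leaf) h = t := by
  induction t with
  | leaf => intro h; simpa using leaf_graft_sigma (fun _ : Fin 1 => (leaf : SRTree Φ 1)) h
  | node φ k t h' ih =>
    intro h
    refine node_congr φ (fun i => ?_) _ _
    have := ih i (by simp)
    conv_rhs => rw [← this]
    exact graft_sigma_congr _ (fun _ => rfl) _ _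

theorem graft_assoc {n : ℕ} (f : SRTree Φ n) : ∀ {m p : ℕ} {k : Fin n → ℕ} {l : Fin m → ℕ}
    {q : Fin n → ℕ} (g : ∀ i, SRTree Φ (k i)) (r : ∀ x, SRTree Φ (l x)) (hm : ∑ i, k i = m)
    (hq : ∀ i, ∑ j, l (blockEquiv k hm ⟨i, j⟩) = q i) (hp : ∑ i, q i = p) (hp' : ∑ x, l x = p),
    graft (graft f g hm) r hp' =
      graft f (fun i => graft (g i) (fun j => r (blockEquiv k hm ⟨i, j⟩)) (hq i)) hp := by
  induction f with
  | leaf =>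
    intro m p k l q g r hm hq hp hp'
    have h0 : k 0 = m := (Fin.sum_univ_one k).symm.trans hm
    subst h0
    have h1 : graft leaf g hm = g 0 := by simpa using leaf_graft_sigma g hm
    have h2 : ∀ j, blockEquiv k hm ⟨0, j⟩ = j := fun j => by
      apply Fin.ext
      rw [blockEquiv_val]
      simp
    rw [h1]
    have h3 := leaf_graft_sigma (fun i => graft (g i)
      (fun j => r (blockEquiv k hm ⟨i, j⟩)) (hq i)) hp
    have h4 := graft_sigma_congr (g 0) (s := r) (s' := fun j => r (blockEquiv k hm ⟨0, j⟩))
      (fun j => by rw [h2]) hp' (hq 0)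
    simpa using h4.trans h3.symm
  | node φ k₀ t h₀ ih =>
    intro m p k l q g r hm hq hp hp'
    refine node_congr φ (fun i => ?_) _ _
    have h1 : ∀ j j', blockEquiv k hm ⟨blockEquiv k₀ h₀ ⟨i, j⟩, j'⟩ =
        blockEquiv (fun i => ∑ j, k (blockEquiv k₀ h₀ ⟨i, j⟩)) (sum_blocks h₀ hm)
          ⟨i, blockEquiv (fun j => k (blockEquiv k₀ h₀ ⟨i, j⟩)) rfl ⟨j, j'⟩⟩ :=
      fun j j' => blockEquiv_assoc h₀ hm (fun _ => rfl) _ i j j'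
    have hq' : ∀ j, ∑ j', l (blockEquiv (fun i => ∑ j, k (blockEquiv k₀ h₀ ⟨i, j⟩))
        (sum_blocks h₀ hm) ⟨i, blockEquiv (fun j => k (blockEquiv k₀ h₀ ⟨i, j⟩)) rfl ⟨j, j'⟩⟩) =
          q (blockEquiv k₀ h₀ ⟨i, j⟩) := fun j => by
      rw [← hq]
      exact Finset.sum_congr rfl fun j' _ => by rw [h1]
    have h2 := ih i (fun j => g (blockEquiv k₀ h₀ ⟨i, j⟩))
      (fun x => r (blockEquiv (fun i => ∑ j, k (blockEquiv k₀ h₀ ⟨i, j⟩)) (sum_blocks h₀ hm) ⟨i, x⟩))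
      rfl hq' rfl (sum_blocks rfl rfl |>.symm.trans (Finset.sum_congr rfl fun j _ => hq' j))
    refine Eq.trans (graft_sigma_congr _ (fun _ => rfl) _ _) ((congrArg (Sigma.mk _) h2).trans ?_)
    refine graft_sigma_congr (t i) (fun j => ?_) _ _
    exact graft_sigma_congr _ (fun j' => by rw [h1]) _ _

end SRTree

/-- The free plain operad on a signature `Φ`. -/
def freePlain (Φ : ℕ → Type u) : PlainOperad.{u} where
  Op := SRTree Φ
  one := SRTree.leaf
  comp f g h := SRTree.graft f g h
  one_comp f h := by simpa using SRTree.leaf_graft_sigma (fun _ : Fin 1 => f) h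
  comp_one f h := SRTree.graft_leaf f h
  assoc {n m p k l q} f g r hm hq hp hp' := by
    have hb : ∀ i, ∑ j, l ((blockEquiv k hm).symm (blockEquiv k hm ⟨i, j⟩)).1
        ((blockEquiv k hm).symm (blockEquiv k hm ⟨i, j⟩)).2 = q i := fun i => by
      rw [← hq i]
      exact Finset.sum_congr rfl fun j _ => by rw [Equiv.symm_apply_apply]
    rw [SRTree.graft_assoc f g _ hm hb hp]
    refine congrArg (fun s => SRTree.graft f s hp) (funext fun i => ?_)
    have := SRTree.graft_sigma_congr (g i) (s := fun j => r
      ((blockEquiv k hm).symm (blockEquiv k hm ⟨i, j⟩)).1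
      ((blockEquiv k hm).symm (blockEquiv k hm ⟨i, j⟩)).2) (s' := r i)
      (fun j => by rw [Equiv.symm_apply_apply]) (hb i) (hq i)
    simpa using this

theorem PlainOperad.assoc_flat (P : PlainOperad.{u}) {n m p : ℕ} {k : Fin n → ℕ} {l : Fin m → ℕ}
    {q : Fin n → ℕ} (f : P.Op n) (g : ∀ i, P.Op (k i)) (r : ∀ x, P.Op (l x)) (hm : ∑ i, k i = m)
    (hq : ∀ i, ∑ j, l (blockEquiv k hm ⟨i, j⟩) = q i) (hp : ∑ i, q i = p) (hp' : ∑ x, l x = p) :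
    P.comp (P.comp f g hm) r hp' =
      P.comp f (fun i => P.comp (g i) (fun j => r (blockEquiv k hm ⟨i, j⟩)) (hq i)) hp := by
  have h1 : ∀ x, (⟨_, r x⟩ : Σ a, P.Op a) = ⟨_, r (blockEquiv k hm
      ⟨((blockEquiv k hm).symm x).1, ((blockEquiv k hm).symm x).2⟩)⟩ := fun x => by
    rw [Sigma.eta, Equiv.apply_symm_apply]
  rw [← P.assoc f g (fun i j => r (blockEquiv k hm ⟨i, j⟩)) hm hq hp]
  · exact P.comp_congr _ h1 _ _
  · rw [← hp']
    exact Finset.sum_congr rfl fun x _ => (congrArg Sigma.fst (h1 x)).symm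

/-- The value in an operad `P` of a tree labelled by operations of `P`. -/
def SRTree.eval (P : PlainOperad.{u}) : {n : ℕ} → SRTree P.Op n → P.Op n
  | _, leaf => P.one
  | _, node φ _ t h => P.comp φ (fun i => eval P (t i)) h

theorem SRTree.eval_graft (P : PlainOperad.{u}) {n : ℕ} (f : SRTree P.Op n) :
    ∀ {m : ℕ} {k : Fin n → ℕ} (g : ∀ i, SRTree P.Op (k i)) (h : ∑ i, k i = m),
      eval P (graft f g h) = P.comp (eval P f) (fun i => eval P (g i)) h := by
  induction f with
  | leaf =>
    intro m k g h
    have h0 : k 0 = m := (Fin.sum_univ_one k).symm.trans h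
    subst h0
    have h1 : graft leaf g h = g 0 := by simpa using leaf_graft_sigma g h
    rw [h1]
    refine Eq.trans (P.one_comp (eval P (g 0)) (by simp)).symm ?_
    exact P.comp_congr _ (fun i => by rw [Subsingleton.elim i 0]) _ _
  | node φ k₀ t h₀ ih =>
    intro m k g h
    refine Eq.trans ?_ (P.assoc_flat φ (fun i => eval P (t i)) (fun x => eval P (g x)) h₀
      (fun _ => rfl) (sum_blocks h₀ h) h).symm
    refine P.comp_congr φ (fun i => congrArg (Sigma.mk _) ?_) _ _
    exact ih i _ rfl

/-- The counit of the adjunction between signatures and plain operads. -/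
def freePlainCounit (P : PlainOperad.{u}) : PlainOperad.Hom (freePlain P.Op) P where
  app t := SRTree.eval P t
  app_one := rfl
  app_comp f g h := SRTree.eval_graft P f g h

/-! ## The free symmetric operad on a plain operad -/

theorem blockPerm_mul {n m : ℕ} (ρ σ : Equiv.Perm (Fin n)) {k : Fin n → ℕ}
    (υ τ : ∀ i, Equiv.Perm (Fin (k i))) (h : ∑ i, k i = m) :
    blockPerm ρ υ h * blockPerm σ (fun i => τ (ρ i)) (sum_comp_perm ρ h) =
      blockPerm (ρ * σ) (fun i => υ i * τ i) h := by
  ext x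
  obtain ⟨⟨j, a⟩, rfl⟩ :=
    (blockEquiv (fun j => k (ρ (σ j))) (sum_comp_perm σ (sum_comp_perm ρ h))).surjective x
  have h1 := blockPerm_blockEquiv σ (fun i => τ (ρ i)) (sum_comp_perm ρ h) j a
  have h2 := blockPerm_blockEquiv ρ υ h (σ j) (τ (ρ (σ j)) a)
  have h3 := blockPerm_blockEquiv (ρ * σ) (fun i => υ i * τ i) h j a
  rw [Equiv.Perm.mul_apply, h1, h2]
  exact congrArg Fin.val h3.symm

theorem blockPerm_one {n m : ℕ} {k : Fin n → ℕ} (h : ∑ i, k i = m) :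
    blockPerm 1 (fun i => (1 : Equiv.Perm (Fin (k i)))) h = 1 := by
  ext x
  obtain ⟨⟨j, a⟩, rfl⟩ := (blockEquiv k h).surjective x
  exact congrArg Fin.val (blockPerm_blockEquiv 1 (fun i => (1 : Equiv.Perm (Fin (k i)))) h j a)

theorem blockEquiv_unit {n : ℕ} (h : ∑ _ : Fin n, 1 = n) (j : Fin n) (a : Fin 1) :
    blockEquiv (fun _ : Fin n => 1) h ⟨j, a⟩ = j := by
  apply Fin.ext
  rw [blockEquiv_val, ← Finset.sum_filter, Finset.sum_const, smul_eq_mul, mul_one]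
  have : (Finset.univ.filter fun b => b < j) = Finset.Iio j := by ext; simp
  rw [this, Fin.card_Iio]
  omega

theorem blockEquiv_single {n : ℕ} (h : ∑ _ : Fin 1, n = n) (j : Fin 1) (a : Fin n) :
    blockEquiv (fun _ : Fin 1 => n) h ⟨j, a⟩ = a := by
  apply Fin.ext
  rw [blockEquiv_val]
  simp

theorem blockPerm_units {n : ℕ} (σ : Equiv.Perm (Fin n)) (h : ∑ _ : Fin n, 1 = n) :
    blockPerm σ (fun _ => 1) h = σ := by
  ext x
  have h1 := blockPerm_blockEquiv σ (fun _ => 1) h x 0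
  rw [blockEquiv_unit, blockEquiv_unit] at h1
  exact congrArg Fin.val h1

theorem blockPerm_single {n : ℕ} (τ : Equiv.Perm (Fin n)) (h : ∑ _ : Fin 1, n = n) :
    blockPerm 1 (fun _ => τ) h = τ := by
  ext x
  have h1 := blockPerm_blockEquiv 1 (fun _ => τ) h 0 x
  rw [blockEquiv_single] at h1
  exact congrArg Fin.val (h1.trans (blockEquiv_single _ _ _))

theorem blockPerm_congr {n m : ℕ} (σ : Equiv.Perm (Fin n)) {k k' : Fin n → ℕ}
    {τ : ∀ i, Equiv.Perm (Fin (k i))} {τ' : ∀ i, Equiv.Perm (Fin (k' i))}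
    (hτ : ∀ i, (⟨k i, τ i⟩ : Σ a, Equiv.Perm (Fin a)) = ⟨k' i, τ' i⟩)
    (h : ∑ i, k i = m) (h' : ∑ i, k' i = m) : blockPerm σ τ h = blockPerm σ τ' h' := by
  obtain rfl : k = k' := funext fun i => congrArg Sigma.fst (hτ i)
  obtain rfl : τ = τ' := funext fun i => by simpa using hτ i
  rfl

theorem blockEquiv_congr {n m : ℕ} {k k' : Fin n → ℕ} (hk : ∀ i, k i = k' i) (h : ∑ i, k i = m)
    (h' : ∑ i, k' i = m) (i : Fin n) (a : Fin (k i)) :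
    blockEquiv k h ⟨i, a⟩ = blockEquiv k' h' ⟨i, Fin.cast (hk i) a⟩ := by
  obtain rfl : k = k' := funext hk
  rfl

theorem blockPerm_assoc {n m p : ℕ} {k : Fin n → ℕ} {l : Fin m → ℕ} {q : Fin n → ℕ}
    (σ : Equiv.Perm (Fin n)) (τ : ∀ i, Equiv.Perm (Fin (k i))) (ρ : ∀ x, Equiv.Perm (Fin (l x)))
    (hm : ∑ i, k i = m) (hq : ∀ i, ∑ j, l (blockEquiv k hm ⟨i, j⟩) = q i) (hp : ∑ i, q i = p)
    (hp' : ∑ x, l x = p) :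
    blockPerm (blockPerm σ τ hm) ρ hp' =
      blockPerm σ (fun i => blockPerm (τ i) (fun j => ρ (blockEquiv k hm ⟨i, j⟩)) (hq i)) hp := by
  refine Equiv.ext fun x => ?_
  obtain ⟨⟨y, b⟩, rfl⟩ := (blockEquiv (fun x => l (blockPerm σ τ hm x))
    (sum_comp_perm (blockPerm σ τ hm) hp')).surjective x
  obtain ⟨⟨i, a⟩, rfl⟩ := (blockEquiv (fun j => k (σ j)) (sum_comp_perm σ hm)).surjective y
  have hw := blockPerm_blockEquiv σ τ hm
  have hl := fun i a => congrArg l (hw i a)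
  have h1 : ∀ (y w : Fin m) (h : y = w) (b : Fin (l y)),
      blockEquiv l hp' ⟨y, ρ y b⟩ = blockEquiv l hp' ⟨w, ρ w (Fin.cast (congrArg l h) b)⟩ := by
    rintro y _ rfl b
    rfl
  rw [blockPerm_blockEquiv (blockPerm σ τ hm) ρ hp', h1 _ _ (hw i a),
    blockEquiv_assoc hm hp' hq hp]
  have hs : ∀ i, ∑ j, l (blockPerm σ τ hm
      (blockEquiv (fun j => k (σ j)) (sum_comp_perm σ hm) ⟨i, j⟩)) = q (σ i) := fun i => by
    rw [Finset.sum_congr rfl fun j _ => hl i j]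
    exact (Equiv.sum_comp (τ (σ i)) fun j => l (blockEquiv k hm ⟨σ i, j⟩)).trans (hq (σ i))
  rw [blockEquiv_assoc (sum_comp_perm σ hm) (sum_comp_perm (blockPerm σ τ hm) hp') hs
    (sum_comp_perm σ hp), blockPerm_blockEquiv σ _ hp,
    blockEquiv_congr (hl i) (hs i) (sum_comp_perm (τ (σ i)) (hq (σ i)))]
  congr 2
  exact (blockPerm_blockEquiv (τ (σ i)) (fun j => ρ (blockEquiv k hm ⟨σ i, j⟩)) (hq (σ i)) a
    (Fin.cast (hl i a) b)).symm

theorem blockPerm_assoc' {n m p : ℕ} {k : Fin n → ℕ} {l : ∀ i, Fin (k i) → ℕ} {q : Fin n → ℕ}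
    (σ : Equiv.Perm (Fin n)) (τ : ∀ i, Equiv.Perm (Fin (k i)))
    (ρ : ∀ i j, Equiv.Perm (Fin (l i j)))
    (hm : ∑ i, k i = m) (hq : ∀ i, ∑ j, l i j = q i) (hp : ∑ i, q i = p)
    (hp' : ∑ x, l ((blockEquiv k hm).symm x).1 ((blockEquiv k hm).symm x).2 = p) :
    blockPerm (blockPerm σ τ hm)
        (fun x => ρ ((blockEquiv k hm).symm x).1 ((blockEquiv k hm).symm x).2) hp' =
      blockPerm σ (fun i => blockPerm (τ i) (ρ i) (hq i)) hp := by
  have hb : ∀ i, ∑ j, l ((blockEquiv k hm).symm (blockEquiv k hm ⟨i, j⟩)).1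
      ((blockEquiv k hm).symm (blockEquiv k hm ⟨i, j⟩)).2 = q i := fun i => by
    rw [← hq i]
    exact Finset.sum_congr rfl fun j _ => by rw [Equiv.symm_apply_apply]
  rw [blockPerm_assoc σ τ _ hm hb hp hp']
  refine blockPerm_congr σ (fun i => ?_) hp hp
  refine congrArg (Sigma.mk (q i)) (blockPerm_congr (τ i) (fun j => ?_) (hb i) (hq i))
  rw [Equiv.symm_apply_apply]

/-- The free symmetric operad on a plain operad: an operation of arity `n` is a pair `(σ, p)` of a
permutation `σ` of `n` points and an operation `p` of arity `n`. -/
def freeSym (P : PlainOperad.{u}) : SymOperad.{u} where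
  Op n := Equiv.Perm (Fin n) × P.Op n
  one := (1, P.one)
  comp x y h := (blockPerm x.1 (fun i => (y i).1) h,
    P.comp x.2 (fun i => (y (x.1 i)).2) (sum_comp_perm x.1 h))
  one_comp x h := Prod.ext (blockPerm_single x.1 h) (P.one_comp x.2 h)
  comp_one x h := Prod.ext (blockPerm_units x.1 h) (P.comp_one x.2 h)
  assoc {n m p k l q} f g r hm hq hp hp' := by
    refine Prod.ext ?_ ?_
    · exact blockPerm_assoc' f.1 (fun i => (g i).1) (fun i j => (r i j).1) hm hq hp hp'
    · have hq' : ∀ i, ∑ j, l (f.1 i) ((g (f.1 i)).1 j) = q (f.1 i) := fun i =>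
        sum_comp_perm (g (f.1 i)).1 (hq (f.1 i))
      have h1 := fun x => blockEquiv_symm_blockPerm f.1 (fun i => (g i).1) hm x
      refine Eq.trans (P.comp_congr _ (fun x => ?_) _ ?_) (P.assoc f.2 (fun i => (g (f.1 i)).2)
        (fun i j => (r (f.1 i) ((g (f.1 i)).1 j)).2) (sum_comp_perm f.1 hm) hq'
        (sum_comp_perm f.1 hp) ?_)
      · simp only
        rw [h1]
      all_goals
        rw [← sum_comp_perm (blockPerm f.1 (fun i => (g i).1) hm) hp']
        exact Finset.sum_congr rfl fun x _ => by rw [h1]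
  act ρ x := (ρ * x.1, x.2)
  one_act x := rfl
  mul_act ρ σ x := rfl
  act_comp ρ x y h :=
    Prod.ext (blockPerm_mul ρ x.1 (fun _ => 1) (fun i => (y i).1) h).symm rfl
  comp_act x ρ y h := Prod.ext (blockPerm_mul 1 x.1 ρ (fun i => (y i).1) h).symm rfl

/-- The action of the free symmetric operad construction on morphisms. -/
def freeSymMap {P Q : PlainOperad.{u}} (φ : PlainOperad.Hom P Q) :
    SymOperad.Hom (freeSym P) (freeSym Q) where
  app x := (x.1, φ.app x.2)
  app_one := Prod.ext rfl φ.app_one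
  app_comp x _ h := Prod.ext rfl (φ.app_comp x.2 _ (sum_comp_perm x.1 h))
  app_act _ _ := rfl

/-- The counit of the adjunction between plain and symmetric operads. -/
def freeSymCounit (P : SymOperad.{u}) : SymOperad.Hom (freeSym P.toPlainOperad) P where
  app x := P.act x.1 x.2
  app_one := P.one_act P.one
  app_comp x y h := by
    change P.act (blockPerm x.1 (fun i => (y i).1) h) (P.comp x.2 _ _) =
      P.comp (P.act x.1 x.2) (fun i => P.act (y i).1 (y i).2) h
    rw [P.act_comp, P.comp_act, ← P.mul_act]
    congr 1
    have := blockPerm_mul x.1 1 (fun _ => 1) (fun i => (y i).1) h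
    simpa using this.symm
  app_act ρ x := P.mul_act ρ x.1 x.2

/-- Composition of morphisms of symmetric operads. -/
def SymOperad.Hom.comp {P Q R : SymOperad.{u}} (φ : SymOperad.Hom P Q) (ψ : SymOperad.Hom Q R) :
    SymOperad.Hom P R where
  app x := ψ.app (φ.app x)
  app_one := by rw [φ.app_one, ψ.app_one]
  app_comp f g h := by rw [φ.app_comp, ψ.app_comp]
  app_act σ f := by rw [φ.app_act, ψ.app_act]

/-- The free symmetric operad on a signature. -/
def freeSymSig (Φ : ℕ → Type u) : SymOperad.{u} := freeSym (freePlain Φ)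

/-- The counit of the adjunction between signatures and symmetric operads. -/
def freeSymSigCounit (P : SymOperad.{u}) : SymOperad.Hom (freeSymSig P.Op) P :=
  (freeSymMap (freePlainCounit P.toPlainOperad)).comp (freeSymCounit P)

/-! ## Operads in categories -/

/-- A plain `Cat`-operad: every `Op n` is a category, composition is functorial, and the axioms
of an operad hold strictly on objects (`1`-cells) and on morphisms (`2`-cells).  The equations
between morphisms are heterogeneous because their sources and targets agree only by the equations
between objects. -/
structure PlainCatOperad extends PlainOperad.{u} where
  [cat : ∀ n, Category.{v} (Op n)]
  compMap : ∀ {n m : ℕ} {k : Fin n → ℕ} {f f' : Op n} {g g' : ∀ i, Op (k i)},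
    (f ⟶ f') → (∀ i, g i ⟶ g' i) → ∀ h : ∑ i, k i = m, (comp f g h ⟶ comp f' g' h)
  compMap_id : ∀ {n m : ℕ} {k : Fin n → ℕ} (f : Op n) (g : ∀ i, Op (k i)) (h : ∑ i, k i = m),
    compMap (𝟙 f) (fun i => 𝟙 (g i)) h = 𝟙 (comp f g h)
  compMap_comp : ∀ {n m : ℕ} {k : Fin n → ℕ} {f f' f'' : Op n} {g g' g'' : ∀ i, Op (k i)}
    (α : f ⟶ f') (α' : f' ⟶ f'') (β : ∀ i, g i ⟶ g' i) (β' : ∀ i, g' i ⟶ g'' i)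
    (h : ∑ i, k i = m),
    compMap (α ≫ α') (fun i => β i ≫ β' i) h = compMap α β h ≫ compMap α' β' h
  one_compMap : ∀ {n : ℕ} {f f' : Op n} (α : f ⟶ f') (h : ∑ _ : Fin 1, n = n),
    HEq (compMap (𝟙 one) (fun _ : Fin 1 => α) h) α
  compMap_one : ∀ {n : ℕ} {f f' : Op n} (α : f ⟶ f') (h : ∑ _ : Fin n, 1 = n),
    HEq (compMap α (fun _ => 𝟙 one) h) α
  compMap_assoc : ∀ {n m p : ℕ} {k : Fin n → ℕ} {l : ∀ i, Fin (k i) → ℕ} {q : Fin n → ℕ}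
    {f f' : Op n} {g g' : ∀ i, Op (k i)} {r r' : ∀ i j, Op (l i j)}
    (α : f ⟶ f') (β : ∀ i, g i ⟶ g' i) (γ : ∀ i j, r i j ⟶ r' i j)
    (hm : ∑ i, k i = m) (hq : ∀ i, ∑ j, l i j = q i) (hp : ∑ i, q i = p)
    (hp' : ∑ x, l ((blockEquiv k hm).symm x).1 ((blockEquiv k hm).symm x).2 = p),
    HEq (compMap (compMap α β hm)
        (fun x => γ ((blockEquiv k hm).symm x).1 ((blockEquiv k hm).symm x).2) hp')
      (compMap α (fun i => compMap (β i) (γ i) (hq i)) hp)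

attribute [instance] PlainCatOperad.cat

/-- A symmetric `Cat`-operad: a plain `Cat`-operad with strict left actions of the symmetric groups
by functors, strictly compatible with composition. -/
structure SymCatOperad extends PlainCatOperad.{u, v}, SymOperad.{u} where
  actMap : ∀ {n : ℕ} (σ : Equiv.Perm (Fin n)) {f f' : Op n}, (f ⟶ f') → (act σ f ⟶ act σ f')
  actMap_id : ∀ {n : ℕ} (σ : Equiv.Perm (Fin n)) (f : Op n), actMap σ (𝟙 f) = 𝟙 (act σ f)
  actMap_comp : ∀ {n : ℕ} (σ : Equiv.Perm (Fin n)) {f f' f'' : Op n} (α : f ⟶ f') (α' : f' ⟶ f''),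
    actMap σ (α ≫ α') = actMap σ α ≫ actMap σ α'
  one_actMap : ∀ {n : ℕ} {f f' : Op n} (α : f ⟶ f'), HEq (actMap 1 α) α
  mul_actMap : ∀ {n : ℕ} (ρ σ : Equiv.Perm (Fin n)) {f f' : Op n} (α : f ⟶ f'),
    HEq (actMap (ρ * σ) α) (actMap ρ (actMap σ α))
  act_compMap : ∀ {n m : ℕ} {k : Fin n → ℕ} (σ : Equiv.Perm (Fin n)) {f f' : Op n}
    {g g' : ∀ i, Op (k i)} (α : f ⟶ f') (β : ∀ i, g i ⟶ g' i) (h : ∑ i, k i = m),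
    HEq (compMap (actMap σ α) β h)
      (actMap (blockPerm σ (fun _ => 1) h) (compMap α (fun i => β (σ i)) (sum_comp_perm σ h)))
  comp_actMap : ∀ {n m : ℕ} {k : Fin n → ℕ} {f f' : Op n} (ρ : ∀ i, Equiv.Perm (Fin (k i)))
    {g g' : ∀ i, Op (k i)} (α : f ⟶ f') (β : ∀ i, g i ⟶ g' i) (h : ∑ i, k i = m),
    HEq (compMap α (fun i => actMap (ρ i) (β i)) h) (actMap (blockPerm 1 ρ h) (compMap α β h))

theorem heq_of_thin {C : Type u} [Category.{v} C] [Quiver.IsThin C] {a b a' b' : C} (ha : a = a')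
    (hb : b = b') (f : a ⟶ b) (g : a' ⟶ b') : HEq f g := by
  subst ha hb
  exact heq_of_eq (Subsingleton.elim f g)

/-! ## Weakenings -/

/-- The category whose objects are the elements of `X`, with exactly one morphism `x ⟶ y` if
`φ x = φ y` and none otherwise.  Equivalently, `X → 𝒞 → Y` is the bijective on objects / full and
faithful factorization of `φ`, where `X` and `Y` are discrete categories. -/
abbrev kernelCategory {X Y : Type u} (φ : X → Y) : Category.{0} X where
  Hom x y := PLift (φ x = φ y)
  id _ := ⟨rfl⟩
  comp f g := ⟨f.down.trans g.down⟩

theorem kernelCategory_isThin {X Y : Type u} (φ : X → Y) :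
    letI := kernelCategory φ; Quiver.IsThin X :=
  fun _ _ => inferInstanceAs (Subsingleton (PLift _))

/-- The weakening of a plain operad `P` with respect to a morphism `φ : F ⟶ P`: the levelwise
bijective on objects / full and faithful factorization of `φ`, regarded as a morphism between
levelwise discrete `Cat`-operads. -/
def PlainOperad.Hom.weakening {F P : PlainOperad.{u}} (φ : PlainOperad.Hom F P) :
    PlainCatOperad.{u, 0} :=
  letI (n : ℕ) := kernelCategory (φ.app (n := n))
  haveI (n : ℕ) := kernelCategory_isThin (φ.app (n := n))
  { F with
    cat := fun n => kernelCategory (φ.app (n := n))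
    compMap := fun {_ _ _ f f' g g'} α β h => ⟨by
      rw [φ.app_comp, φ.app_comp, show φ.app f = φ.app f' from α.down]
      exact congrArg (fun s => P.comp (φ.app f') s h) (funext fun i => (β i).down)⟩
    compMap_id := fun _ _ _ => rfl
    compMap_comp := fun _ _ _ _ _ => rfl
    one_compMap := fun _ h => heq_of_thin (F.one_comp _ h) (F.one_comp _ h) _ _
    compMap_one := fun _ h => heq_of_thin (F.comp_one _ h) (F.comp_one _ h) _ _
    compMap_assoc := fun _ _ _ hm hq hp hp' =>
      heq_of_thin (F.assoc _ _ _ hm hq hp hp') (F.assoc _ _ _ hm hq hp hp') _ _ }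

/-- The weakening of a symmetric operad `P` with respect to a morphism `φ : F ⟶ P`: the levelwise
bijective on objects / full and faithful factorization of `φ`, regarded as a morphism between
levelwise discrete symmetric `Cat`-operads. -/
def SymOperad.Hom.weakening {F P : SymOperad.{u}} (φ : SymOperad.Hom F P) :
    SymCatOperad.{u, 0} :=
  letI (n : ℕ) := kernelCategory (φ.app (n := n))
  haveI (n : ℕ) := kernelCategory_isThin (φ.app (n := n))
  { F, φ.toHom.weakening with
    actMap := fun {_} σ {f f'} α => ⟨by
      rw [φ.app_act, φ.app_act, show φ.app f = φ.app f' from α.down]⟩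
    actMap_id := fun _ _ => rfl
    actMap_comp := fun _ _ _ _ _ _ => rfl
    one_actMap := fun _ => heq_of_thin (F.one_act _) (F.one_act _) _ _
    mul_actMap := fun ρ σ _ _ _ => heq_of_thin (F.mul_act ρ σ _) (F.mul_act ρ σ _) _ _
    act_compMap := fun σ _ _ _ _ _ _ h => heq_of_thin (F.act_comp σ _ _ h) (F.act_comp σ _ _ h) _ _
    comp_actMap := fun ρ _ _ _ _ h => heq_of_thin (F.comp_act _ ρ _ h) (F.comp_act _ ρ _ h) _ _ }

/-- The unbiased weakening `Wk(P)` of a plain operad. -/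
def PlainOperad.Wk (P : PlainOperad.{u}) : PlainCatOperad.{u, 0} := (freePlainCounit P).weakening

/-- The unbiased weakening `Wk(P)` of a symmetric operad. -/
def SymOperad.Wk (P : SymOperad.{u}) : SymCatOperad.{u, 0} := (freeSymSigCounit P).weakening

/-! ## The free symmetric `Cat`-operad on a plain `Cat`-operad -/

/-- Morphisms between pairs of a permutation and an operation: the permutations (which form a
discrete category) are equal, and there is a morphism between the operations. -/
structure FreeSymHom (Q : PlainCatOperad.{u, v}) {n : ℕ} (x y : Equiv.Perm (Fin n) × Q.Op n) :
    Type v where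
  perm : x.1 = y.1
  hom : x.2 ⟶ y.2

namespace FreeSymHom

variable {Q : PlainCatOperad.{u, v}}

theorem ext' {n : ℕ} {x y : Equiv.Perm (Fin n) × Q.Op n} {α β : FreeSymHom Q x y}
    (h : α.hom = β.hom) : α = β := by
  cases α; cases β; cases h; rfl

theorem heq_ext {n : ℕ} {x y x' y' : Equiv.Perm (Fin n) × Q.Op n} {α : FreeSymHom Q x y}
    {α' : FreeSymHom Q x' y'} (hx : x = x') (hy : y = y') (h : HEq α.hom α'.hom) : HEq α α' := by
  subst hx hy
  exact heq_of_eq (ext' (eq_of_heq h))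

theorem blockPerm_eq {n m : ℕ} {σ σ' : Equiv.Perm (Fin n)} {k : Fin n → ℕ}
    {τ τ' : ∀ i, Equiv.Perm (Fin (k i))} (hσ : σ = σ') (hτ : ∀ i, τ i = τ' i)
    (h : ∑ i, k i = m) : blockPerm σ τ h = blockPerm σ' τ' h := by
  obtain rfl : τ = τ' := funext hτ
  rw [hσ]

/-- The second component of the composition of `2`-cells in the free symmetric `Cat`-operad. -/
def compHom {n m : ℕ} {k : Fin n → ℕ} {σ σ' : Equiv.Perm (Fin n)} (hσ : σ = σ') {p p' : Q.Op n}
    {q q' : ∀ i, Q.Op (k i)} (α : p ⟶ p') (β : ∀ i, q i ⟶ q' i) (h : ∑ i, k i = m) :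
    Q.comp p (fun i => q (σ i)) (sum_comp_perm σ h) ⟶
      Q.comp p' (fun i => q' (σ' i)) (sum_comp_perm σ' h) :=
  match σ', hσ with
  | _, rfl => Q.compMap α (fun i => β (σ i)) (sum_comp_perm σ h)

/-- Composition of `2`-cells in the free symmetric `Cat`-operad. -/
def comp {n m : ℕ} {k : Fin n → ℕ} {x x' : Equiv.Perm (Fin n) × Q.Op n}
    {y y' : ∀ i, Equiv.Perm (Fin (k i)) × Q.Op (k i)} (α : FreeSymHom Q x x')
    (β : ∀ i, FreeSymHom Q (y i) (y' i)) (h : ∑ i, k i = m) :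
    FreeSymHom Q ((freeSym Q.toPlainOperad).comp x y h)
      ((freeSym Q.toPlainOperad).comp x' y' h) where
  perm := blockPerm_eq α.perm (fun i => (β i).perm) h
  hom := compHom α.perm α.hom (fun i => (β i).hom) h

end FreeSymHom

theorem PlainCatOperad.compMap_heq (Q : PlainCatOperad.{u, v}) {n m : ℕ} {k k' : Fin n → ℕ}
    {f f' : Q.Op n} {g₁ g₂ : ∀ i, Q.Op (k i)} {g₁' g₂' : ∀ i, Q.Op (k' i)} (α : f ⟶ f')
    {β : ∀ i, g₁ i ⟶ g₂ i} {β' : ∀ i, g₁' i ⟶ g₂' i}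
    (hβ : ∀ i, (⟨k i, g₁ i, g₂ i, β i⟩ : Σ (a : ℕ) (x y : Q.Op a), (x ⟶ y)) =
      ⟨k' i, g₁' i, g₂' i, β' i⟩)
    (h : ∑ i, k i = m) (h' : ∑ i, k' i = m) : HEq (Q.compMap α β h) (Q.compMap α β' h') := by
  obtain rfl : k = k' := funext fun i => congrArg Sigma.fst (hβ i)
  simp only [Sigma.mk.injEq, heq_eq_eq, true_and] at hβ
  obtain rfl : g₁ = g₁' := funext fun i => (hβ i).1
  simp only [heq_eq_eq, true_and, Sigma.mk.injEq] at hβ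
  obtain rfl : g₂ = g₂' := funext fun i => (hβ i).1
  simp only [heq_eq_eq, true_and] at hβ
  obtain rfl : β = β' := funext fun i => hβ i
  rfl

/-- The free symmetric `Cat`-operad on a plain `Cat`-operad. -/
def freeSymCat (Q : PlainCatOperad.{u, v}) : SymCatOperad.{u, v} where
  toSymOperad := freeSym Q.toPlainOperad
  cat n :=
    { Hom := fun x y => FreeSymHom Q x y
      id := fun x => ⟨rfl, 𝟙 x.2⟩
      comp := fun α β => ⟨α.perm.trans β.perm, α.hom ≫ β.hom⟩
      id_comp := fun _ => FreeSymHom.ext' (Category.id_comp _)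
      comp_id := fun _ => FreeSymHom.ext' (Category.comp_id _)
      assoc := fun _ _ _ => FreeSymHom.ext' (Category.assoc _ _ _) }
  compMap α β h := FreeSymHom.comp α β h
  compMap_id f g h := FreeSymHom.ext' (Q.compMap_id f.2 (fun i => (g (f.1 i)).2) _)
  compMap_comp := by
    rintro n m k ⟨σ, f⟩ ⟨_, f'⟩ ⟨_, f''⟩ g g' g'' ⟨h₁, α⟩ ⟨h₂, α'⟩ β β' h
    cases h₁
    cases h₂
    exact FreeSymHom.ext' (Q.compMap_comp α α' _ _ _)
  one_compMap α h :=
    FreeSymHom.heq_ext ((freeSym _).one_comp _ h) ((freeSym _).one_comp _ h)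
      (Q.one_compMap α.hom h)
  compMap_one := by
    rintro n ⟨σ, f⟩ ⟨_, f'⟩ ⟨h₁, α⟩ h
    cases h₁
    exact FreeSymHom.heq_ext ((freeSym _).comp_one _ h) ((freeSym _).comp_one _ h)
      (Q.compMap_one α h)
  compMap_assoc := by
    rintro n m p k l q ⟨σ, f⟩ ⟨_, f'⟩ g g' r r' ⟨h₁, α⟩ β γ hm hq hp hp'
    cases h₁
    obtain ⟨τ, g, rfl⟩ : ∃ τ g₀, g = fun i => (τ i, g₀ i) :=
      ⟨fun i => (g i).1, fun i => (g i).2, rfl⟩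
    obtain ⟨τ', g', rfl⟩ : ∃ τ g₀, g' = fun i => (τ i, g₀ i) :=
      ⟨fun i => (g' i).1, fun i => (g' i).2, rfl⟩
    obtain rfl : τ = τ' := funext fun i => (β i).perm
    obtain ⟨β, rfl⟩ : ∃ β₀ : ∀ i, g i ⟶ g' i, β = fun i => ⟨rfl, β₀ i⟩ :=
      ⟨fun i => (β i).hom, rfl⟩
    refine FreeSymHom.heq_ext ((freeSym _).assoc _ _ _ hm hq hp hp')
      ((freeSym _).assoc _ _ _ hm hq hp hp') ?_
    have h1 := fun x => blockEquiv_symm_blockPerm σ τ hm x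
    refine HEq.trans (Q.compMap_heq _ (fun x => ?_) _ ?_) (Q.compMap_assoc α (fun i => β (σ i))
      (fun i j => (γ (σ i) (τ (σ i) j)).hom) (sum_comp_perm σ hm)
      (fun i => sum_comp_perm (τ (σ i)) (hq (σ i))) (sum_comp_perm σ hp) ?_)
    · exact congrArg (fun y : Σ i, Fin (k i) =>
        (⟨l y.1 y.2, (r y.1 y.2).2, (r' y.1 y.2).2, (γ y.1 y.2).hom⟩ :
          Σ (a : ℕ) (x y : Q.Op a), (x ⟶ y))) (h1 x)
    all_goals
      rw [← sum_comp_perm (blockPerm σ τ hm) hp']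
      exact Finset.sum_congr rfl fun x _ => by rw [h1]
  actMap := fun {_} ρ {_ _} α => ⟨congrArg (fun σ => ρ * σ) α.perm, α.hom⟩
  actMap_id _ _ := rfl
  actMap_comp _ _ _ _ _ _ := rfl
  one_actMap _ := HEq.rfl
  mul_actMap _ _ _ _ _ := HEq.rfl
  act_compMap := by
    rintro n m k ρ ⟨σ, f⟩ ⟨_, f'⟩ g g' ⟨h₁, α⟩ β h
    cases h₁
    exact FreeSymHom.heq_ext ((freeSym _).act_comp ρ _ _ h) ((freeSym _).act_comp ρ _ _ h) HEq.rfl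
  comp_actMap := by
    rintro n m k ⟨σ, f⟩ ⟨_, f'⟩ ρ g g' ⟨h₁, α⟩ β h
    cases h₁
    exact FreeSymHom.heq_ext ((freeSym _).comp_act _ ρ _ h) ((freeSym _).comp_act _ ρ _ h) HEq.rfl

/-! ## The `2`-category of symmetric `Cat`-operads -/

/-- Morphisms of symmetric `Cat`-operads. -/
structure SymCatOperad.Hom (P Q : SymCatOperad.{u, v}) where
  app : ∀ {n : ℕ}, P.Op n → Q.Op n
  app_one : app P.one = Q.one
  app_comp : ∀ {n m : ℕ} {k : Fin n → ℕ} (f : P.Op n) (g : ∀ i, P.Op (k i)) (h : ∑ i, k i = m),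
    app (P.comp f g h) = Q.comp (app f) (fun i => app (g i)) h
  app_act : ∀ {n : ℕ} (σ : Equiv.Perm (Fin n)) (f : P.Op n), app (P.act σ f) = Q.act σ (app f)
  map : ∀ {n : ℕ} {f f' : P.Op n}, (f ⟶ f') → (app f ⟶ app f')
  map_id : ∀ {n : ℕ} (f : P.Op n), map (𝟙 f) = 𝟙 (app f)
  map_comp : ∀ {n : ℕ} {f f' f'' : P.Op n} (α : f ⟶ f') (α' : f' ⟶ f''),
    map (α ≫ α') = map α ≫ map α'
  map_compMap : ∀ {n m : ℕ} {k : Fin n → ℕ} {f f' : P.Op n} {g g' : ∀ i, P.Op (k i)}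
    (α : f ⟶ f') (β : ∀ i, g i ⟶ g' i) (h : ∑ i, k i = m),
    HEq (map (P.compMap α β h)) (Q.compMap (map α) (fun i => map (β i)) h)
  map_actMap : ∀ {n : ℕ} (σ : Equiv.Perm (Fin n)) {f f' : P.Op n} (α : f ⟶ f'),
    HEq (map (P.actMap σ α)) (Q.actMap σ (map α))

/-- Transformations between morphisms of symmetric `Cat`-operads: levelwise natural transformations
that are compatible with composition, identities and the symmetric group actions. -/
structure SymCatOperad.Hom.Trans {P Q : SymCatOperad.{u, v}} (F G : SymCatOperad.Hom P Q) where
  app : ∀ {n : ℕ} (f : P.Op n), F.app f ⟶ G.app f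
  naturality : ∀ {n : ℕ} {f f' : P.Op n} (α : f ⟶ f'), F.map α ≫ app f' = app f ≫ G.map α
  app_one : HEq (app P.one) (𝟙 Q.one)
  app_comp : ∀ {n m : ℕ} {k : Fin n → ℕ} (f : P.Op n) (g : ∀ i, P.Op (k i)) (h : ∑ i, k i = m),
    HEq (app (P.comp f g h)) (Q.compMap (app f) (fun i => app (g i)) h)
  app_act : ∀ {n : ℕ} (σ : Equiv.Perm (Fin n)) (f : P.Op n),
    HEq (app (P.act σ f)) (Q.actMap σ (app f))

theorem heq_comp_of_eq {C : Type u} [Category.{v} C] {a b c a' b' c' : C} (ha : a = a')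
    (hb : b = b') (hc : c = c') {f : a ⟶ b} {f' : a' ⟶ b'} {g : b ⟶ c} {g' : b' ⟶ c'}
    (hf : HEq f f') (hg : HEq g g') : HEq (f ≫ g) (f' ≫ g') := by
  subst ha hb hc hf hg
  rfl

theorem heq_id_of_eq {C : Type u} [Category.{v} C] {a a' : C} (ha : a = a') :
    HEq (𝟙 a) (𝟙 a') := by
  subst ha
  rfl

namespace SymCatOperad

variable {P Q R : SymCatOperad.{u, v}}

namespace Hom

theorem map_heq (F : Hom P Q) {n : ℕ} {a b a' b' : P.Op n} (ha : a = a') (hb : b = b')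
    {α : a ⟶ b} {α' : a' ⟶ b'} (h : HEq α α') : HEq (F.map α) (F.map α') := by
  subst ha hb h
  rfl

/-- The identity morphism. -/
def id (P : SymCatOperad.{u, v}) : Hom P P where
  app f := f
  app_one := rfl
  app_comp _ _ _ := rfl
  app_act _ _ := rfl
  map α := α
  map_id _ := rfl
  map_comp _ _ := rfl
  map_compMap _ _ _ := HEq.rfl
  map_actMap _ _ _ _ := HEq.rfl

/-- Composition of morphisms. -/
def comp (F : Hom P Q) (G : Hom Q R) : Hom P R where
  app f := G.app (F.app f)
  app_one := by rw [F.app_one, G.app_one]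
  app_comp f g h := by rw [F.app_comp, G.app_comp]
  app_act σ f := by rw [F.app_act, G.app_act]
  map α := G.map (F.map α)
  map_id f := by rw [F.map_id, G.map_id]
  map_comp α α' := by rw [F.map_comp, G.map_comp]
  map_compMap α β h :=
    (G.map_heq (F.app_comp _ _ h) (F.app_comp _ _ h) (F.map_compMap α β h)).trans
      (G.map_compMap _ _ h)
  map_actMap σ _ _ α :=
    (G.map_heq (F.app_act σ _) (F.app_act σ _) (F.map_actMap σ α)).trans (G.map_actMap σ _)

namespace Trans

theorem ext' {F G : Hom P Q} {η θ : Trans F G} (h : ∀ {n : ℕ} (f : P.Op n), η.app f = θ.app f) :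
    η = θ := by
  cases η; cases θ
  congr
  funext n f
  exact h f

theorem app_heq {F G : Hom P Q} (η : Trans F G) {n : ℕ} {f f' : P.Op n} (h : f = f') :
    HEq (η.app f) (η.app f') := by
  subst h
  rfl

/-- The identity transformation. -/
def id (F : Hom P Q) : Trans F F where
  app f := 𝟙 (F.app f)
  naturality α := by rw [Category.comp_id, Category.id_comp]
  app_one := heq_id_of_eq F.app_one
  app_comp f g h := by
    rw [Q.compMap_id]
    exact heq_id_of_eq (F.app_comp f g h)
  app_act σ f := by
    rw [Q.actMap_id]
    exact heq_id_of_eq (F.app_act σ f)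

/-- Vertical composition of transformations. -/
def vcomp {F G H : Hom P Q} (η : Trans F G) (θ : Trans G H) : Trans F H where
  app f := η.app f ≫ θ.app f
  naturality α := by
    rw [← Category.assoc, η.naturality, Category.assoc, θ.naturality, Category.assoc]
  app_one := by
    have := heq_comp_of_eq F.app_one G.app_one H.app_one η.app_one θ.app_one
    rwa [Category.comp_id] at this
  app_comp f g h := by
    rw [Q.compMap_comp]
    exact heq_comp_of_eq (F.app_comp f g h) (G.app_comp f g h) (H.app_comp f g h)
      (η.app_comp f g h) (θ.app_comp f g h)
  app_act σ f := by
    rw [Q.actMap_comp]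
    exact heq_comp_of_eq (F.app_act σ f) (G.app_act σ f) (H.app_act σ f)
      (η.app_act σ f) (θ.app_act σ f)

/-- Whiskering on the left. -/
def whiskerLeft (F : Hom P Q) {G H : Hom Q R} (η : Trans G H) : Trans (F.comp G) (F.comp H) where
  app f := η.app (F.app f)
  naturality α := η.naturality (F.map α)
  app_one := (η.app_heq F.app_one).trans η.app_one
  app_comp f g h := (η.app_heq (F.app_comp f g h)).trans (η.app_comp _ _ h)
  app_act σ f := (η.app_heq (F.app_act σ f)).trans (η.app_act σ _)

/-- Whiskering on the right. -/
def whiskerRight {F G : Hom P Q} (η : Trans F G) (H : Hom Q R) : Trans (F.comp H) (G.comp H) where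
  app f := H.map (η.app f)
  naturality α := by
    change H.map (F.map α) ≫ H.map _ = H.map _ ≫ H.map (G.map α)
    rw [← H.map_comp, η.naturality, H.map_comp]
  app_one := by
    refine (H.map_heq F.app_one G.app_one η.app_one).trans ?_
    rw [H.map_id]
    exact heq_id_of_eq H.app_one
  app_comp f g h :=
    (H.map_heq (F.app_comp f g h) (G.app_comp f g h) (η.app_comp f g h)).trans
      (H.map_compMap _ _ h)
  app_act σ f :=
    (H.map_heq (F.app_act σ f) (G.app_act σ f) (η.app_act σ f)).trans (H.map_actMap σ _)

end Trans

instance : Category (Hom P Q) where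
  Hom F G := Trans F G
  id F := Trans.id F
  comp η θ := Trans.vcomp η θ
  id_comp _ := Trans.ext' fun _ => Category.id_comp _
  comp_id _ := Trans.ext' fun _ => Category.comp_id _
  assoc _ _ _ := Trans.ext' fun _ => Category.assoc _ _ _

end Hom

instance : Bicategory SymCatOperad.{u, v} where
  Hom P Q := Hom P Q
  id P := Hom.id P
  comp F G := Hom.comp F G
  homCategory P Q := inferInstance
  whiskerLeft F _ _ η := Hom.Trans.whiskerLeft F η
  whiskerRight η H := Hom.Trans.whiskerRight η H
  associator F G H := Iso.refl (Hom.comp F (Hom.comp G H))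
  leftUnitor F := Iso.refl F
  rightUnitor F := Iso.refl F
  whiskerLeft_id _ _ := rfl
  whiskerLeft_comp _ _ _ _ _ _ := rfl
  id_whiskerLeft η := Hom.Trans.ext' fun f => ((Category.id_comp _).trans (Category.comp_id _)).symm
  comp_whiskerLeft F G _ _ η := Hom.Trans.ext' fun f => ((Category.id_comp _).trans (Category.comp_id _)).symm
  id_whiskerRight F G := Hom.Trans.ext' fun f => G.map_id _
  comp_whiskerRight η θ H := Hom.Trans.ext' fun f => H.map_comp _ _
  whiskerRight_id η := Hom.Trans.ext' fun f => ((Category.id_comp _).trans (Category.comp_id _)).symm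
  whiskerRight_comp η G H := Hom.Trans.ext' fun f => ((Category.id_comp _).trans (Category.comp_id _)).symm
  whisker_assoc F _ _ η H := Hom.Trans.ext' fun f => ((Category.id_comp _).trans (Category.comp_id _)).symm
  whisker_exchange η θ := Hom.Trans.ext' fun f => (Hom.Trans.naturality θ (Hom.Trans.app η f)).symm
  pentagon F G H K := Hom.Trans.ext' fun f => by
    change K.map (𝟙 _) ≫ 𝟙 _ ≫ 𝟙 _ = 𝟙 _ ≫ 𝟙 _
    rw [K.map_id, Category.id_comp]
  triangle F G := Hom.Trans.ext' fun f => by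
    change 𝟙 _ ≫ 𝟙 _ = G.map (𝟙 _)
    rw [G.map_id, Category.id_comp]

instance : Bicategory.Strict SymCatOperad.{u, v} where
  id_comp _ := rfl
  comp_id _ := rfl
  assoc _ _ _ := rfl
  leftUnitor_eqToIso _ := rfl
  rightUnitor_eqToIso _ := rfl
  associator_eqToIso _ _ _ := rfl

end SymCatOperad

/-! ## Algebras, weak morphisms and transformations -/

/-- An algebra in `Cat` for a plain `Cat`-operad `Q`: a category `A` with functors
`Q.Op n × Aⁿ → A` that are strictly compatible with identities and composition. -/
structure PlainCatOperad.Algebra (Q : PlainCatOperad.{u, v}) where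
  carrier : Type w
  [cat : Category.{z} carrier]
  obj : ∀ {n : ℕ}, Q.Op n → (Fin n → carrier) → carrier
  map : ∀ {n : ℕ} {f f' : Q.Op n} {a a' : Fin n → carrier},
    (f ⟶ f') → (∀ i, a i ⟶ a' i) → (obj f a ⟶ obj f' a')
  map_id : ∀ {n : ℕ} (f : Q.Op n) (a : Fin n → carrier),
    map (𝟙 f) (fun i => 𝟙 (a i)) = 𝟙 (obj f a)
  map_comp : ∀ {n : ℕ} {f f' f'' : Q.Op n} {a a' a'' : Fin n → carrier} (α : f ⟶ f')
    (α' : f' ⟶ f'') (x : ∀ i, a i ⟶ a' i) (x' : ∀ i, a' i ⟶ a'' i),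
    map (α ≫ α') (fun i => x i ≫ x' i) = map α x ≫ map α' x'
  obj_one : ∀ a : Fin 1 → carrier, obj Q.one a = a 0
  map_one : ∀ {a a' : Fin 1 → carrier} (x : ∀ i, a i ⟶ a' i), HEq (map (𝟙 Q.one) x) (x 0)
  obj_opComp : ∀ {n m : ℕ} {k : Fin n → ℕ} (f : Q.Op n) (g : ∀ i, Q.Op (k i)) (h : ∑ i, k i = m)
    (a : Fin m → carrier),
    obj (Q.comp f g h) a = obj f (fun i => obj (g i) (fun j => a (blockEquiv k h ⟨i, j⟩)))
  map_compMap : ∀ {n m : ℕ} {k : Fin n → ℕ} {f f' : Q.Op n} {g g' : ∀ i, Q.Op (k i)}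
    {a a' : Fin m → carrier} (α : f ⟶ f') (β : ∀ i, g i ⟶ g' i) (h : ∑ i, k i = m)
    (x : ∀ i, a i ⟶ a' i),
    HEq (map (Q.compMap α β h) x)
      (map α (fun i => map (β i) (fun j => x (blockEquiv k h ⟨i, j⟩))))

attribute [instance] PlainCatOperad.Algebra.cat

/-- An algebra in `Cat` for a symmetric `Cat`-operad: the symmetric groups act by permuting the
arguments. -/
structure SymCatOperad.Algebra (Q : SymCatOperad.{u, v}) extends
    PlainCatOperad.Algebra.{u, v, w, z} Q.toPlainCatOperad where
  obj_act : ∀ {n : ℕ} (σ : Equiv.Perm (Fin n)) (f : Q.Op n) (a : Fin n → carrier),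
    obj (Q.act σ f) a = obj f (fun i => a (σ i))
  map_actMap : ∀ {n : ℕ} (σ : Equiv.Perm (Fin n)) {f f' : Q.Op n} {a a' : Fin n → carrier}
    (α : f ⟶ f') (x : ∀ i, a i ⟶ a' i), HEq (map (Q.actMap σ α) x) (map α (fun i => x (σ i)))

namespace PlainCatOperad.Algebra

variable {Q : PlainCatOperad.{u, v}}

/-- Weak morphisms of algebras for a plain `Cat`-operad: a functor together with invertible
coherence maps. -/
structure WeakHom (A B : Algebra.{u, v, w, z} Q) where
  functor : A.carrier ⥤ B.carrier
  coh : ∀ {n : ℕ} (f : Q.Op n) (a : Fin n → A.carrier),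
    B.obj f (fun i => functor.obj (a i)) ≅ functor.obj (A.obj f a)
  naturality : ∀ {n : ℕ} {f f' : Q.Op n} {a a' : Fin n → A.carrier} (α : f ⟶ f')
    (x : ∀ i, a i ⟶ a' i),
    B.map α (fun i => functor.map (x i)) ≫ (coh f' a').hom =
      (coh f a).hom ≫ functor.map (A.map α x)
  coh_one : ∀ a : Fin 1 → A.carrier, HEq (coh Q.one a).hom (𝟙 (functor.obj (a 0)))
  coh_comp : ∀ {n m : ℕ} {k : Fin n → ℕ} (f : Q.Op n) (g : ∀ i, Q.Op (k i)) (h : ∑ i, k i = m)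
    (a : Fin m → A.carrier),
    HEq (coh (Q.comp f g h) a).hom
      (B.map (𝟙 f) (fun i => (coh (g i) (fun j => a (blockEquiv k h ⟨i, j⟩))).hom) ≫
        (coh f (fun i => A.obj (g i) (fun j => a (blockEquiv k h ⟨i, j⟩)))).hom)

/-- Transformations between weak morphisms of algebras. -/
structure WeakHom.Trans {A B : Algebra.{u, v, w, z} Q} (F G : WeakHom A B) where
  nat : F.functor ⟶ G.functor
  comm : ∀ {n : ℕ} (f : Q.Op n) (a : Fin n → A.carrier),
    B.map (𝟙 f) (fun i => nat.app (a i)) ≫ (G.coh f a).hom =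
      (F.coh f a).hom ≫ nat.app (A.obj f a)

namespace WeakHom

variable {A B C D : Algebra.{u, v, w, z} Q}

theorem ext' {F G : WeakHom A B} (h : F.functor = G.functor)
    (hc : ∀ {n : ℕ} (f : Q.Op n) (a : Fin n → A.carrier), HEq (F.coh f a).hom (G.coh f a).hom) :
    F = G := by
  obtain ⟨F, c, h1, h2, h3⟩ := F
  obtain ⟨G, d, h4, h5, h6⟩ := G
  dsimp only at h
  subst h
  have : @c = @d := by
    funext n f a
    exact Iso.ext (eq_of_heq (hc f a))
  subst this
  rfl

/-- The identity weak morphism. -/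
def id (A : Algebra.{u, v, w, z} Q) : WeakHom A A where
  functor := 𝟭 A.carrier
  coh f a := Iso.refl (A.obj f a)
  naturality α x := by
    change A.map α x ≫ 𝟙 _ = 𝟙 _ ≫ A.map α x
    rw [Category.comp_id, Category.id_comp]
  coh_one a := heq_id_of_eq (A.obj_one a)
  coh_comp f g h a := by
    change HEq (𝟙 _) (A.map (𝟙 f) (fun i => 𝟙 _) ≫ 𝟙 _)
    rw [A.map_id, Category.comp_id]
    exact heq_id_of_eq (A.obj_opComp f g h a)

theorem functor_map_heq {A : Type w} [Category.{z} A] {B : Type w} [Category.{z} B] (F : A ⥤ B)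
    {a b a' b' : A} (ha : a = a') (hb : b = b') {x : a ⟶ b} {x' : a' ⟶ b'} (h : HEq x x') :
    HEq (F.map x) (F.map x') := by
  subst ha hb h
  rfl

/-- Composition of weak morphisms. -/
def comp (F : WeakHom A B) (G : WeakHom B C) : WeakHom A C where
  functor := F.functor ⋙ G.functor
  coh f a := G.coh f (fun i => F.functor.obj (a i)) ≪≫ G.functor.mapIso (F.coh f a)
  naturality α x := by
    change C.map α (fun i => G.functor.map (F.functor.map (x i))) ≫
      (G.coh _ _).hom ≫ G.functor.map (F.coh _ _).hom =
      ((G.coh _ _).hom ≫ G.functor.map (F.coh _ _).hom) ≫ G.functor.map (F.functor.map (A.map α x))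
    rw [← Category.assoc, G.naturality, Category.assoc, Category.assoc, ← G.functor.map_comp,
      F.naturality, G.functor.map_comp]
  coh_one a := by
    have h1 := G.coh_one (fun i => F.functor.obj (a i))
    have h2 : HEq (G.functor.map (F.coh Q.one a).hom)
        (𝟙 (G.functor.obj (F.functor.obj (a 0)))) := by
      rw [← G.functor.map_id]
      exact functor_map_heq _ (B.obj_one _) (congrArg F.functor.obj (A.obj_one a)) (F.coh_one a)
    have := heq_comp_of_eq (C.obj_one _) (congrArg G.functor.obj (B.obj_one _))
      (congrArg G.functor.obj (congrArg F.functor.obj (A.obj_one a))) h1 h2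
    rwa [Category.comp_id] at this
  coh_comp f g h a := by
    have h1 := G.coh_comp f g h (fun i => F.functor.obj (a i))
    have h2 := functor_map_heq G.functor (B.obj_opComp f g h (fun i => F.functor.obj (a i)))
      (congrArg F.functor.obj (A.obj_opComp f g h a)) (F.coh_comp f g h a)
    refine (heq_comp_of_eq (C.obj_opComp _ _ _ _) (congrArg G.functor.obj (B.obj_opComp _ _ _ _))
      (congrArg G.functor.obj (congrArg F.functor.obj (A.obj_opComp f g h a))) h1 h2).trans ?_
    refine heq_of_eq ?_
    have h3 := G.naturality (𝟙 f)
      (fun i => (F.coh (g i) (fun j => a (blockEquiv _ h ⟨i, j⟩))).hom)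
    have h4 := C.map_comp (𝟙 f) (𝟙 f)
      (fun i => (G.coh (g i) (fun j => F.functor.obj (a (blockEquiv _ h ⟨i, j⟩)))).hom)
      (fun i => G.functor.map (F.coh (g i) (fun j => a (blockEquiv _ h ⟨i, j⟩))).hom)
    rw [Category.comp_id] at h4
    refine Eq.trans ?_ (congrArg (fun y => y ≫ _) h4.symm)
    change (_ ≫ _) ≫ G.functor.map (_ ≫ _) = (_ ≫ _) ≫ (_ ≫ G.functor.map _)
    rw [G.functor.map_comp, Category.assoc, Category.assoc, ← Category.assoc (G.coh _ _).hom,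
      ← h3, Category.assoc]

namespace Trans

theorem ext' {F G : WeakHom A B} {η θ : Trans F G} (h : ∀ a, η.nat.app a = θ.nat.app a) :
    η = θ := by
  cases η; cases θ
  congr
  ext a
  exact h a

/-- The identity transformation. -/
def id (F : WeakHom A B) : Trans F F where
  nat := 𝟙 F.functor
  comm f a := by
    change B.map (𝟙 f) (fun i => 𝟙 _) ≫ _ = _ ≫ 𝟙 _
    rw [B.map_id, Category.comp_id, Category.id_comp]

/-- Vertical composition of transformations. -/
def vcomp {F G H : WeakHom A B} (η : Trans F G) (θ : Trans G H) : Trans F H where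
  nat := η.nat ≫ θ.nat
  comm f a := by
    have h := B.map_comp (𝟙 f) (𝟙 f) (fun i => η.nat.app (a i)) (fun i => θ.nat.app (a i))
    rw [Category.comp_id] at h
    change B.map (𝟙 f) (fun i => η.nat.app (a i) ≫ θ.nat.app (a i)) ≫ _ = _ ≫ _ ≫ _
    rw [h, Category.assoc, θ.comm, ← Category.assoc, η.comm, Category.assoc]

/-- Whiskering on the left. -/
def whiskerLeft (F : WeakHom A B) {G H : WeakHom B C} (η : Trans G H) :
    Trans (F.comp G) (F.comp H) where
  nat := Functor.whiskerLeft F.functor η.nat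
  comm f a := by
    change C.map (𝟙 f) (fun i => η.nat.app (F.functor.obj (a i))) ≫ (H.coh _ _).hom ≫
      H.functor.map _ = ((G.coh _ _).hom ≫ G.functor.map _) ≫ η.nat.app _
    rw [← Category.assoc, η.comm, Category.assoc, Category.assoc, η.nat.naturality]

/-- Whiskering on the right. -/
def whiskerRight {F G : WeakHom A B} (η : Trans F G) (H : WeakHom B C) :
    Trans (F.comp H) (G.comp H) where
  nat := Functor.whiskerRight η.nat H.functor
  comm f a := by
    change C.map (𝟙 f) (fun i => H.functor.map (η.nat.app (a i))) ≫ (H.coh _ _).hom ≫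
      H.functor.map _ = ((H.coh _ _).hom ≫ H.functor.map _) ≫ H.functor.map _
    rw [← Category.assoc, H.naturality, Category.assoc, Category.assoc, ← H.functor.map_comp,
      ← H.functor.map_comp, η.comm]

end Trans

instance : Category (WeakHom A B) where
  Hom F G := Trans F G
  id F := Trans.id F
  comp η θ := Trans.vcomp η θ
  id_comp _ := Trans.ext' fun _ => Category.id_comp _
  comp_id _ := Trans.ext' fun _ => Category.comp_id _
  assoc _ _ _ := Trans.ext' fun _ => Category.assoc _ _ _

theorem eqToHom_nat_app {F G : WeakHom A B} (h : F = G) (a : A.carrier) :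
    (Trans.nat (F := F) (G := G) (eqToHom h)).app a = eqToHom (by rw [h]) := by
  subst h
  rfl

theorem id_comp (F : WeakHom A B) : (id A).comp F = F :=
  ext' rfl fun f a => heq_of_eq (by
    change (F.coh f a).hom ≫ F.functor.map (𝟙 _) = _
    rw [F.functor.map_id]
    exact Category.comp_id _)

theorem comp_id (F : WeakHom A B) : F.comp (id B) = F :=
  ext' rfl fun _ _ => heq_of_eq (Category.id_comp _)

theorem assoc (F : WeakHom A B) (G : WeakHom B C) (H : WeakHom C D) :
    (F.comp G).comp H = F.comp (G.comp H) :=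
  ext' rfl fun f a => heq_of_eq (by
    have h := H.functor.map_comp (G.coh f (fun i => F.functor.obj (a i))).hom
      (G.functor.map (F.coh f a).hom)
    exact (congrArg (fun y => (H.coh f (fun i => G.functor.obj (F.functor.obj (a i)))).hom ≫ y)
      h).trans (Category.assoc _ _ _).symm)

theorem id_comp_hom_app (F : WeakHom A B) (a : A.carrier) :
    (Trans.nat (F := (id A).comp F) (G := F) (eqToHom (id_comp F))).app a =
      𝟙 (F.functor.obj a) :=
  eqToHom_nat_app _ _

theorem id_comp_inv_app (F : WeakHom A B) (a : A.carrier) :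
    (Trans.nat (F := F) (G := (id A).comp F) (eqToHom (id_comp F).symm)).app a =
      𝟙 (F.functor.obj a) :=
  eqToHom_nat_app _ _

theorem comp_id_hom_app (F : WeakHom A B) (a : A.carrier) :
    (Trans.nat (F := F.comp (id B)) (G := F) (eqToHom (comp_id F))).app a =
      𝟙 (F.functor.obj a) :=
  eqToHom_nat_app _ _

theorem comp_id_inv_app (F : WeakHom A B) (a : A.carrier) :
    (Trans.nat (F := F) (G := F.comp (id B)) (eqToHom (comp_id F).symm)).app a =
      𝟙 (F.functor.obj a) :=
  eqToHom_nat_app _ _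

theorem assoc_hom_app (F : WeakHom A B) (G : WeakHom B C) (H : WeakHom C D) (a : A.carrier) :
    (Trans.nat (F := (F.comp G).comp H) (G := F.comp (G.comp H))
      (eqToHom (assoc F G H))).app a =
      𝟙 (H.functor.obj (G.functor.obj (F.functor.obj a))) :=
  eqToHom_nat_app _ _

theorem assoc_inv_app (F : WeakHom A B) (G : WeakHom B C) (H : WeakHom C D) (a : A.carrier) :
    (Trans.nat (F := F.comp (G.comp H)) (G := (F.comp G).comp H)
      (eqToHom (assoc F G H).symm)).app a = 𝟙 (H.functor.obj (G.functor.obj (F.functor.obj a))) :=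
  eqToHom_nat_app _ _

theorem conj_id {E : Type w} [Category.{z} E] {a b : E} {x : a ⟶ a} {y : b ⟶ b} (hx : x = 𝟙 a)
    (hy : y = 𝟙 b) (f : a ⟶ b) : f = x ≫ f ≫ y := by
  rw [hx, hy, Category.id_comp, Category.comp_id]

end WeakHom

instance : Bicategory (Algebra.{u, v, w, z} Q) where
  Hom A B := WeakHom A B
  id A := WeakHom.id A
  comp F G := WeakHom.comp F G
  homCategory A B := inferInstance
  whiskerLeft F _ _ η := WeakHom.Trans.whiskerLeft F η
  whiskerRight η H := WeakHom.Trans.whiskerRight η H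
  associator F G H := eqToIso (WeakHom.assoc F G H)
  leftUnitor F := eqToIso (WeakHom.id_comp F)
  rightUnitor F := eqToIso (WeakHom.comp_id F)
  whiskerLeft_id _ _ := rfl
  whiskerLeft_comp _ _ _ _ _ _ := rfl
  id_whiskerLeft {_ _ F G} η := WeakHom.Trans.ext' fun a =>
    WeakHom.conj_id (WeakHom.id_comp_hom_app F a) (WeakHom.id_comp_inv_app G a) _
  comp_whiskerLeft F G _ _ η := WeakHom.Trans.ext' fun a =>
    WeakHom.conj_id (WeakHom.assoc_hom_app _ _ _ a) (WeakHom.assoc_inv_app _ _ _ a) _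
  id_whiskerRight F G := WeakHom.Trans.ext' fun f => G.functor.map_id _
  comp_whiskerRight η θ H := WeakHom.Trans.ext' fun f => H.functor.map_comp _ _
  whiskerRight_id {_ _ F G} η := WeakHom.Trans.ext' fun a =>
    WeakHom.conj_id (WeakHom.comp_id_hom_app F a) (WeakHom.comp_id_inv_app G a) _
  whiskerRight_comp η G H := WeakHom.Trans.ext' fun a =>
    WeakHom.conj_id (WeakHom.assoc_inv_app _ _ _ a) (WeakHom.assoc_hom_app _ _ _ a) _
  whisker_assoc F _ _ η H := WeakHom.Trans.ext' fun a =>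
    WeakHom.conj_id (WeakHom.assoc_hom_app _ _ _ a) (WeakHom.assoc_inv_app _ _ _ a) _
  whisker_exchange η θ := WeakHom.Trans.ext' fun f => (θ.nat.naturality (η.nat.app f)).symm
  pentagon F G H K := WeakHom.Trans.ext' fun a => by
    have h1 := WeakHom.assoc_hom_app F G H a
    have h2 := WeakHom.assoc_hom_app F (G.comp H) K a
    have h3 := WeakHom.assoc_hom_app G H K (F.functor.obj a)
    have h4 := WeakHom.assoc_hom_app (F.comp G) H K a
    have h5 := WeakHom.assoc_hom_app F G (H.comp K) a
    have h6 := (congrArg K.functor.map h1).trans (K.functor.map_id _)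
    exact (congrArg₂ (· ≫ ·) h6 (congrArg₂ (· ≫ ·) h2 h3)).trans
      ((Category.id_comp _).trans (congrArg₂ (· ≫ ·) h4 h5).symm)
  triangle F G := WeakHom.Trans.ext' fun a => by
    have h1 := WeakHom.assoc_hom_app F (WeakHom.id _) G a
    have h2 := WeakHom.id_comp_hom_app G (F.functor.obj a)
    have h3 := WeakHom.comp_id_hom_app F a
    have h4 := (congrArg G.functor.map h3).trans (G.functor.map_id _)
    exact (congrArg₂ (· ≫ ·) h1 h2).trans ((Category.id_comp _).trans h4.symm)

instance : Bicategory.Strict (Algebra.{u, v, w, z} Q) where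
  id_comp {A B} F := WeakHom.id_comp (A := A) (B := B) F
  comp_id {A B} F := WeakHom.comp_id (A := A) (B := B) F
  assoc {A B C D} F G H := WeakHom.assoc (A := A) (B := B) (C := C) (D := D) F G H
  leftUnitor_eqToIso _ := rfl
  rightUnitor_eqToIso _ := rfl
  associator_eqToIso _ _ _ := rfl

end PlainCatOperad.Algebra

namespace SymCatOperad.Algebra

variable {Q : SymCatOperad.{u, v}}

/-- Weak morphisms of algebras for a symmetric `Cat`-operad: the coherence maps are moreover
compatible with the symmetric group actions. -/
structure WeakHom (A B : Algebra.{u, v, w, z} Q) extends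
    PlainCatOperad.Algebra.WeakHom A.toAlgebra B.toAlgebra where
  coh_act : ∀ {n : ℕ} (σ : Equiv.Perm (Fin n)) (f : Q.Op n) (a : Fin n → A.carrier),
    HEq (coh (Q.act σ f) a).hom (coh f (fun i => a (σ i))).hom

namespace WeakHom

variable {A B C D : Algebra.{u, v, w, z} Q}

theorem ext' {F G : WeakHom A B} (h : F.toWeakHom = G.toWeakHom) : F = G := by
  cases F; cases G; cases h; rfl

/-- The identity weak morphism. -/
def id (A : Algebra.{u, v, w, z} Q) : WeakHom A A where
  toWeakHom := PlainCatOperad.Algebra.WeakHom.id A.toAlgebra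
  coh_act σ f a := heq_id_of_eq (A.obj_act σ f a)

/-- Composition of weak morphisms. -/
def comp (F : WeakHom A B) (G : WeakHom B C) : WeakHom A C where
  toWeakHom := F.toWeakHom.comp G.toWeakHom
  coh_act σ f a :=
    heq_comp_of_eq (C.obj_act σ f _) (congrArg G.functor.obj (B.obj_act σ f _))
      (congrArg G.functor.obj (congrArg F.functor.obj (A.obj_act σ f a)))
      (G.coh_act σ f (fun i => F.functor.obj (a i)))
      (PlainCatOperad.Algebra.WeakHom.functor_map_heq G.functor (B.obj_act σ f _)
        (congrArg F.functor.obj (A.obj_act σ f a)) (F.coh_act σ f a))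

/-- The `2`-cells between weak morphisms of algebras for a symmetric `Cat`-operad are the
transformations between the underlying weak morphisms of algebras for the plain `Cat`-operad. -/
instance : Category (WeakHom A B) where
  Hom F G := PlainCatOperad.Algebra.WeakHom.Trans F.toWeakHom G.toWeakHom
  id F := PlainCatOperad.Algebra.WeakHom.Trans.id F.toWeakHom
  comp η θ := PlainCatOperad.Algebra.WeakHom.Trans.vcomp η θ
  id_comp _ := PlainCatOperad.Algebra.WeakHom.Trans.ext' fun _ => Category.id_comp _
  comp_id _ := PlainCatOperad.Algebra.WeakHom.Trans.ext' fun _ => Category.comp_id _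
  assoc _ _ _ := PlainCatOperad.Algebra.WeakHom.Trans.ext' fun _ => Category.assoc _ _ _

/-- Isomorphic underlying weak morphisms are isomorphic. -/
def liftIso {F G : WeakHom A B} (e : F.toWeakHom ≅ G.toWeakHom) : F ≅ G where
  hom := show PlainCatOperad.Algebra.WeakHom.Trans F.toWeakHom G.toWeakHom from e.hom
  inv := show PlainCatOperad.Algebra.WeakHom.Trans G.toWeakHom F.toWeakHom from e.inv
  hom_inv_id := e.hom_inv_id
  inv_hom_id := e.inv_hom_id

end WeakHom

instance : Bicategory (Algebra.{u, v, w, z} Q) where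
  Hom A B := WeakHom A B
  id A := WeakHom.id A
  comp F G := WeakHom.comp F G
  homCategory A B := inferInstanceAs (Category (WeakHom A B))
  whiskerLeft {A B C} F {G H} η :=
    PlainCatOperad.Algebra.WeakHom.Trans.whiskerLeft (WeakHom.toWeakHom F)
      (G := WeakHom.toWeakHom G) (H := WeakHom.toWeakHom H) η
  whiskerRight {A B C F G} η H :=
    PlainCatOperad.Algebra.WeakHom.Trans.whiskerRight (F := WeakHom.toWeakHom F)
      (G := WeakHom.toWeakHom G) η (WeakHom.toWeakHom H)
  associator F G H := WeakHom.liftIso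
    (eqToIso (PlainCatOperad.Algebra.WeakHom.assoc F.toWeakHom G.toWeakHom H.toWeakHom))
  leftUnitor F := WeakHom.liftIso
    (eqToIso (PlainCatOperad.Algebra.WeakHom.id_comp F.toWeakHom))
  rightUnitor F := WeakHom.liftIso
    (eqToIso (PlainCatOperad.Algebra.WeakHom.comp_id F.toWeakHom))
  whiskerLeft_id _ _ := rfl
  whiskerLeft_comp _ _ _ _ _ _ := rfl
  id_whiskerLeft {A B F G} η :=
    Bicategory.id_whiskerLeft (a := A.toAlgebra) (b := B.toAlgebra)
      (f := WeakHom.toWeakHom F) (g := WeakHom.toWeakHom G) η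
  comp_whiskerLeft {A B C D} F G {H K} η :=
    Bicategory.comp_whiskerLeft (a := A.toAlgebra) (b := B.toAlgebra) (c := C.toAlgebra)
      (d := D.toAlgebra) (WeakHom.toWeakHom F) (WeakHom.toWeakHom G)
      (h := WeakHom.toWeakHom H) (h' := WeakHom.toWeakHom K) η
  id_whiskerRight {A B C} F G :=
    Bicategory.id_whiskerRight (a := A.toAlgebra) (b := B.toAlgebra) (c := C.toAlgebra)
      (WeakHom.toWeakHom F) (WeakHom.toWeakHom G)
  comp_whiskerRight {A B C F G H} η θ K :=
    Bicategory.comp_whiskerRight (a := A.toAlgebra) (b := B.toAlgebra) (c := C.toAlgebra)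
      (f := WeakHom.toWeakHom F) (g := WeakHom.toWeakHom G) (h := WeakHom.toWeakHom H) η θ
      (WeakHom.toWeakHom K)
  whiskerRight_id {A B F G} η :=
    Bicategory.whiskerRight_id (a := A.toAlgebra) (b := B.toAlgebra)
      (f := WeakHom.toWeakHom F) (g := WeakHom.toWeakHom G) η
  whiskerRight_comp {A B C D F G} η H K :=
    Bicategory.whiskerRight_comp (a := A.toAlgebra) (b := B.toAlgebra) (c := C.toAlgebra)
      (d := D.toAlgebra) (f := WeakHom.toWeakHom F) (f' := WeakHom.toWeakHom G) η
      (WeakHom.toWeakHom H) (WeakHom.toWeakHom K)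
  whisker_assoc {A B C D} F {G H} η K :=
    Bicategory.whisker_assoc (a := A.toAlgebra) (b := B.toAlgebra) (c := C.toAlgebra)
      (d := D.toAlgebra) (WeakHom.toWeakHom F) (g := WeakHom.toWeakHom G)
      (g' := WeakHom.toWeakHom H) η (WeakHom.toWeakHom K)
  whisker_exchange {A B C F G H K} η θ :=
    Bicategory.whisker_exchange (a := A.toAlgebra) (b := B.toAlgebra) (c := C.toAlgebra)
      (f := WeakHom.toWeakHom F) (g := WeakHom.toWeakHom G) (h := WeakHom.toWeakHom H)
      (i := WeakHom.toWeakHom K) η θ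
  pentagon {A B C D E} F G H K :=
    Bicategory.pentagon (a := A.toAlgebra) (b := B.toAlgebra) (c := C.toAlgebra)
      (d := D.toAlgebra) (e := E.toAlgebra) (WeakHom.toWeakHom F) (WeakHom.toWeakHom G)
      (WeakHom.toWeakHom H) (WeakHom.toWeakHom K)
  triangle {A B C} F G :=
    Bicategory.triangle (a := A.toAlgebra) (b := B.toAlgebra) (c := C.toAlgebra)
      (WeakHom.toWeakHom F) (WeakHom.toWeakHom G)

theorem liftIso_eqToIso {A B : Algebra.{u, v, w, z} Q} {F G : WeakHom A B} (h : F = G)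
    (h' : F.toWeakHom = G.toWeakHom) : WeakHom.liftIso (eqToIso h') = eqToIso h := by
  subst h
  exact Iso.ext rfl

instance : Bicategory.Strict (Algebra.{u, v, w, z} Q) where
  id_comp {A B} F := WeakHom.ext' (A := A) (B := B)
    (PlainCatOperad.Algebra.WeakHom.id_comp (WeakHom.toWeakHom F))
  comp_id {A B} F := WeakHom.ext' (A := A) (B := B)
    (PlainCatOperad.Algebra.WeakHom.comp_id (WeakHom.toWeakHom F))
  assoc {A B C D} F G H := WeakHom.ext' (A := A) (B := D)
    (PlainCatOperad.Algebra.WeakHom.assoc (WeakHom.toWeakHom F) (WeakHom.toWeakHom G)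
      (WeakHom.toWeakHom H))
  leftUnitor_eqToIso {A B} F := liftIso_eqToIso (A := A) (B := B) _ _
  rightUnitor_eqToIso {A B} F := liftIso_eqToIso (A := A) (B := B) _ _
  associator_eqToIso {A B C D} F G H := liftIso_eqToIso (A := A) (B := D) _ _

end SymCatOperad.Algebra

/-! ## Equivalence of strict `2`-categories -/

section

open Bicategory

/-- An equivalence of strict `2`-categories: strict `2`-functors in both directions whose
composites are isomorphic to the identities by invertible strict `2`-natural transformations.
In particular, it is an equivalence between the underlying ordinary categories. -/
structure TwoEquivalence (B : Type*) [Bicategory B] [Bicategory.Strict B]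
    (C : Type*) [Bicategory C] [Bicategory.Strict C] where
  functor : StrictPseudofunctor B C
  inverse : StrictPseudofunctor C B
  unitIso : 𝟭 B ≅ functor.toFunctor ⋙ inverse.toFunctor
  counitIso : inverse.toFunctor ⋙ functor.toFunctor ≅ 𝟭 C
  unit_naturality : ∀ {a b : B} {f g : a ⟶ b} (η : f ⟶ g),
    HEq (η ▷ unitIso.hom.app b) (unitIso.hom.app a ◁ inverse.map₂ (functor.map₂ η))
  counit_naturality : ∀ {a b : C} {f g : a ⟶ b} (η : f ⟶ g),
    HEq (functor.map₂ (inverse.map₂ η) ▷ counitIso.hom.app b) (counitIso.hom.app a ◁ η)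

end

/-- The `2`-category of weak `P`-categories, weak `P`-functors and `P`-transformations, for a plain
operad `P`. -/
abbrev PlainOperad.WkCat (P : PlainOperad.{u}) := PlainCatOperad.Algebra.{u, 0, w, z} P.Wk

/-- The `2`-category of weak `P`-categories, weak `P`-functors and `P`-transformations, for a
symmetric operad `P`. -/
abbrev SymOperad.WkCat (P : SymOperad.{u}) := SymCatOperad.Algebra.{u, 0, w, z} P.Wk

/-! Equivalence of the two operads. The 1-cells of `freeSymCat P.Wk` are the operations of the free
symmetric operad on the signature `n ↦ P(n)`, and those of `(freeSym P).Wk` are the operations of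
the free symmetric operad on `n ↦ S_n × P(n)`. On both sides the operations have values in `freeSym
P`, and there is one 2-cell between two operations if their values agree and none otherwise. Hence a
morphism of symmetric operads that respects values extends uniquely to 2-cells, and two such
morphisms are isomorphic as soon as they agree on values, all coherence equations being trivial.
Freeness gives a morphism each way, determined by `x ↦ (1, x)` and by `(σ, x) ↦ σ · x` on
generators. Both commute with evaluation in `freeSym P` (`counit_signatureInclusion`,
`counit_signatureCollapse`), so both round trips are isomorphic to the identity.

Failure of isomorphism. An isomorphism would restrict to an isomorphism between the free symmetric
operads of 1-cells. The number of vertices of a tree is additive under composition, unchanged by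
permutations, and zero only for the identity. An injective morphism therefore cannot decrease it, so
an isomorphism sends generators to permuted generators, and the number of generators of each arity
is an invariant (`subsingleton_of_freeSymSig_iso` is the case needed). For the terminal operad the
two signatures have one and two symbols of arity 2.

Equivalence of the 2-categories of algebras. For any plain `Cat`-operad `Q`, an algebra for
`freeSymCat Q` is determined by its restriction to `Q`, because equivariance forces the action of
`(σ, p) = σ · (1, p)`; this is `freeSymEquivalence`. Moreover, an equivalence of symmetric
`Cat`-operads induces a strict equivalence of the 2-categories of algebras (`restrictEquivalence`):
an isomorphism between two operad morphisms supplies the coherence maps of a weak morphism whose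
underlying functor is the identity, and the inverse 2-cells give its strict inverse. The result is
the composite of these two equivalences. -/

/-! ## Universal properties of the free operads -/

namespace SRTree

variable {Φ : ℕ → Type u}

/-- The tree with one vertex. -/
def corolla {n : ℕ} (x : Φ n) : SRTree Φ n :=
  node x (fun _ => 1) (fun _ => leaf) (by simp)

/-- Each leaf of the corolla is replaced by the corresponding tree. Read backwards, this turns the
constructor `node` into an operadic composite. -/
theorem corolla_graft {n m : ℕ} {k : Fin n → ℕ} (x : Φ n) (t : ∀ i, SRTree Φ (k i))
    (h : ∑ i, k i = m) : graft (corolla x) t h = node x k t h := by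
  refine node_congr x (fun i => ?_) _ _
  refine (leaf_graft_sigma _ _).trans ?_
  rw [blockEquiv_unit]

/-- The value of a tree in an operad, given the values of its labels. -/
def lift (Q : PlainOperad.{v}) (φ : ∀ {n : ℕ}, Φ n → Q.Op n) : {n : ℕ} → SRTree Φ n → Q.Op n
  | _, leaf => Q.one
  | _, node x _ t h => Q.comp (φ x) (fun i => lift Q φ (t i)) h

theorem lift_corolla (Q : PlainOperad.{v}) (φ : ∀ {n : ℕ}, Φ n → Q.Op n) {n : ℕ} (x : Φ n) :
    lift Q φ (corolla x) = φ x :=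
  Q.comp_one (φ x) _

/-- By induction on `f`: the leaf case is the left unit law of `Q`, and the node case is
associativity. -/
theorem lift_graft (Q : PlainOperad.{v}) (φ : ∀ {n : ℕ}, Φ n → Q.Op n) {n : ℕ}
    (f : SRTree Φ n) : ∀ {m : ℕ} {k : Fin n → ℕ} (g : ∀ i, SRTree Φ (k i)) (h : ∑ i, k i = m),
      lift Q φ (graft f g h) = Q.comp (lift Q φ f) (fun i => lift Q φ (g i)) h := by
  induction f with
  | leaf =>
    intro m k g h
    have h0 : k 0 = m := (Fin.sum_univ_one k).symm.trans h
    subst h0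
    have h1 : graft leaf g h = g 0 := by simpa using leaf_graft_sigma g h
    rw [h1]
    refine Eq.trans (Q.one_comp (lift Q φ (g 0)) (by simp)).symm ?_
    exact Q.comp_congr _ (fun i => by rw [Subsingleton.elim i 0]) _ _
  | node x k₀ t h₀ ih =>
    intro m k g h
    refine Eq.trans ?_ (Q.assoc_flat (φ x) (fun i => lift Q φ (t i)) (fun y => lift Q φ (g y)) h₀
      (fun _ => rfl) (sum_blocks h₀ h) h).symm
    exact Q.comp_congr _ (fun i => congrArg (Sigma.mk _) (ih i _ rfl)) _ _

theorem eval_corolla (P : PlainOperad.{u}) {n : ℕ} (x : P.Op n) : eval P (corolla x) = x :=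
  P.comp_one x _

end SRTree

/-- The morphism out of a free plain operad given by the images of the generators. -/
def freePlainLift {Φ : ℕ → Type u} (Q : PlainOperad.{u}) (φ : ∀ {n : ℕ}, Φ n → Q.Op n) :
    PlainOperad.Hom (freePlain Φ) Q where
  app t := SRTree.lift Q φ t
  app_one := rfl
  app_comp f g h := SRTree.lift_graft Q φ f g h

/-- Structural induction phrased with the operad operations only, which is the form in which
morphisms of operads can be compared. -/
theorem freePlain_induction {Φ : ℕ → Type u} {motive : ∀ {n : ℕ}, (freePlain Φ).Op n → Prop}
    (one : motive (freePlain Φ).one)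
    (comp : ∀ {n m : ℕ} {k : Fin n → ℕ} (x : Φ n) (t : ∀ i, (freePlain Φ).Op (k i))
      (h : ∑ i, k i = m), (∀ i, motive (t i)) →
        motive ((freePlain Φ).comp (SRTree.corolla x) t h)) :
    ∀ {n : ℕ} (t : (freePlain Φ).Op n), motive t := by
  intro n t
  induction t with
  | leaf => exact one
  | node x k t h ih =>
    rw [← SRTree.corolla_graft x t h]
    exact comp x t h ih

theorem freePlain_hom_ext {Φ : ℕ → Type u} {Q : PlainOperad.{u}}
    {φ ψ : PlainOperad.Hom (freePlain Φ) Q}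
    (H : ∀ {n : ℕ} (x : Φ n), φ.app (SRTree.corolla x) = ψ.app (SRTree.corolla x)) {n : ℕ}
    (t : (freePlain Φ).Op n) : φ.app t = ψ.app t := by
  refine freePlain_induction (motive := fun t => φ.app t = ψ.app t) ?_ ?_ t
  · rw [φ.app_one, ψ.app_one]
  · intro n m k x t h ih
    refine (φ.app_comp _ t h).trans (Eq.trans ?_ (ψ.app_comp _ t h).symm)
    exact congrArg₂ (fun y s => Q.comp y s h) (H x) (funext ih)

/-- The unit of the adjunction between plain and symmetric operads. -/
def freeSymUnit (P : PlainOperad.{u}) : PlainOperad.Hom P (freeSym P).toPlainOperad where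
  app x := (1, x)
  app_one := rfl
  app_comp f g h := Prod.ext (blockPerm_one h).symm rfl

/-- Composition of morphisms of plain operads. -/
def PlainOperad.Hom.comp {P Q R : PlainOperad.{u}} (φ : PlainOperad.Hom P Q)
    (ψ : PlainOperad.Hom Q R) : PlainOperad.Hom P R where
  app x := ψ.app (φ.app x)
  app_one := by rw [φ.app_one, ψ.app_one]
  app_comp f g h := by rw [φ.app_comp, ψ.app_comp]

/-- The morphism out of a free symmetric operad given by the images of the generators. -/
def freeSymSigLift {Φ : ℕ → Type u} (R : SymOperad.{u}) (φ : ∀ {n : ℕ}, Φ n → R.Op n) :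
    SymOperad.Hom (freeSymSig Φ) R :=
  (freeSymMap (freePlainLift R.toPlainOperad φ)).comp (freeSymCounit R)

/-- The generator of the free symmetric operad that is given by an operation symbol. -/
def freeSymSigGen {Φ : ℕ → Type u} {n : ℕ} (x : Φ n) : (freeSymSig Φ).Op n :=
  (1, SRTree.corolla x)

theorem freeSymSigLift_gen {Φ : ℕ → Type u} (R : SymOperad.{u})
    (φ : ∀ {n : ℕ}, Φ n → R.Op n) {n : ℕ} (x : Φ n) :
    (freeSymSigLift R φ).app (freeSymSigGen x) = φ x :=
  (R.one_act _).trans (SRTree.lift_corolla R.toPlainOperad φ x)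

theorem freeSymSigCounit_gen (R : SymOperad.{u}) {n : ℕ} (x : R.Op n) :
    (freeSymSigCounit R).app (freeSymSigGen x) = x :=
  (R.one_act _).trans (SRTree.eval_corolla R.toPlainOperad x)

theorem freeSymSig_hom_ext {Φ : ℕ → Type u} {R : SymOperad.{u}}
    {φ ψ : SymOperad.Hom (freeSymSig Φ) R}
    (H : ∀ {n : ℕ} (x : Φ n), φ.app (freeSymSigGen x) = ψ.app (freeSymSigGen x)) {n : ℕ}
    (t : (freeSymSig Φ).Op n) : φ.app t = ψ.app t := by
  obtain ⟨σ, t⟩ := t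
  -- `(σ, t)` is definitionally `σ` acting on `(1, t)`, so equivariance reduces the claim to the
  -- free plain operad.
  have h1 := φ.app_act σ ((freeSymUnit (freePlain Φ)).app t)
  have h2 := ψ.app_act σ ((freeSymUnit (freePlain Φ)).app t)
  exact h1.trans ((congrArg (R.act σ) (freePlain_hom_ext (φ := (freeSymUnit _).comp φ.toHom)
    (ψ := (freeSymUnit _).comp ψ.toHom) H t)).trans h2.symm)

/-! ## Morphisms between locally thin symmetric `Cat`-operads -/

namespace SymCatOperad

variable {P Q : SymCatOperad.{u, v}}

/-- A morphism into a symmetric `Cat`-operad whose categories of operations are thin is determined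
by a morphism of symmetric operads that preserves the existence of `2`-cells. -/
def Hom.ofThin [∀ n, Quiver.IsThin (Q.Op n)] (φ : SymOperad.Hom P.toSymOperad Q.toSymOperad)
    (map : ∀ {n : ℕ} {f f' : P.Op n}, (f ⟶ f') → ((φ.app f : Q.Op n) ⟶ φ.app f')) :
    Hom P Q where
  app f := φ.app f
  app_one := φ.app_one
  app_comp := φ.app_comp
  app_act := φ.app_act
  map := map
  map_id _ := Subsingleton.elim _ _
  map_comp _ _ := Subsingleton.elim _ _
  map_compMap _ _ _ := heq_of_thin (φ.app_comp _ _ _) (φ.app_comp _ _ _) _ _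
  map_actMap _ _ _ _ := heq_of_thin (φ.app_act _ _) (φ.app_act _ _) _ _

/-- A transformation into a symmetric `Cat`-operad whose categories of operations are thin. -/
def Hom.Trans.ofThin [∀ n, Quiver.IsThin (Q.Op n)] {F G : Hom P Q}
    (app : ∀ {n : ℕ} (f : P.Op n), F.app f ⟶ G.app f) : Trans F G where
  app := app
  naturality _ := Subsingleton.elim _ _
  app_one := heq_of_thin F.app_one G.app_one _ _
  app_comp f g h := heq_of_thin (F.app_comp f g h) (G.app_comp f g h) _ _
  app_act σ f := heq_of_thin (F.app_act σ f) (G.app_act σ f) _ _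

/-- An isomorphism between morphisms into a symmetric `Cat`-operad whose categories of operations
are thin. -/
def Hom.isoOfThin [∀ n, Quiver.IsThin (Q.Op n)] {F G : Hom P Q}
    (hom : ∀ {n : ℕ} (f : P.Op n), F.app f ⟶ G.app f)
    (inv : ∀ {n : ℕ} (f : P.Op n), G.app f ⟶ F.app f) : F ≅ G where
  hom := Trans.ofThin hom
  inv := Trans.ofThin inv
  hom_inv_id := Trans.ext' fun _ => Subsingleton.elim _ _
  inv_hom_id := Trans.ext' fun _ => Subsingleton.elim _ _

end SymCatOperad

/-! ## The equivalence between the two weakenings -/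

/-- Thinness of these categories is what makes the equations between 2-cells automatic in the
comparison of the two weakenings. -/
instance (P : SymOperad.{u}) (n : ℕ) : Quiver.IsThin (P.Wk.Op n) :=
  kernelCategory_isThin ((freeSymSigCounit P).app (n := n))

instance (P : PlainOperad.{u}) (n : ℕ) : Quiver.IsThin (P.Wk.Op n) :=
  kernelCategory_isThin ((freePlainCounit P).app (n := n))

instance (Q : PlainCatOperad.{u, v}) [∀ n, Quiver.IsThin (Q.Op n)] (n : ℕ) :
    Quiver.IsThin ((freeSymCat Q).Op n) :=
  fun _ _ => ⟨fun _ _ => FreeSymHom.ext' (Subsingleton.elim _ _)⟩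

section

variable (P : PlainOperad.{u})

/-- The morphism from the free symmetric operad on the signature of `P` to the free symmetric operad
on the signature of `freeSym P`. -/
def signatureInclusion : SymOperad.Hom (freeSymSig P.Op) (freeSymSig (freeSym P).Op) :=
  freeSymSigLift _ fun x => freeSymSigGen (Φ := (freeSym P).Op) (1, x)

/-- The morphism from the free symmetric operad on the signature of `freeSym P` to the free
symmetric operad on the signature of `P`. -/
def signatureCollapse : SymOperad.Hom (freeSymSig (freeSym P).Op) (freeSymSig P.Op) :=
  freeSymSigLift _ fun x => (freeSymSig P.Op).act x.1 (freeSymSigGen x.2)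

/-- Two morphisms out of a free symmetric operad agree if they agree on generators; here both send
the generator of `x` to `(1, x)`. -/
theorem counit_signatureInclusion {n : ℕ} (x : (freeSymSig P.Op).Op n) :
    (freeSymSigCounit (freeSym P)).app ((signatureInclusion P).app x) =
      (freeSymMap (freePlainCounit P)).app x := by
  refine freeSymSig_hom_ext (φ := (signatureInclusion P).comp (freeSymSigCounit (freeSym P)))
    (ψ := freeSymMap (freePlainCounit P)) (fun {n} x => ?_) x
  refine (congrArg (freeSymSigCounit (freeSym P)).app (freeSymSigLift_gen _ _ x)).trans ?_
  refine (freeSymSigCounit_gen (freeSym P) _).trans ?_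
  exact Prod.ext rfl (SRTree.eval_corolla P x).symm

/-- Again a comparison on generators: `(σ, p)` collapses to `σ` acting on the generator of `p`,
whose value is `(σ, p)`. -/
theorem counit_signatureCollapse {n : ℕ} (x : (freeSymSig (freeSym P).Op).Op n) :
    (freeSymMap (freePlainCounit P)).app ((signatureCollapse P).app x) =
      (freeSymSigCounit (freeSym P)).app x := by
  refine freeSymSig_hom_ext (φ := (signatureCollapse P).comp (freeSymMap (freePlainCounit P)))
    (ψ := freeSymSigCounit (freeSym P)) (fun {n} x => ?_) x
  refine (congrArg (freeSymMap (freePlainCounit P)).app (freeSymSigLift_gen _ _ x)).trans ?_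
  rw [freeSymSigCounit_gen]
  exact Prod.ext rfl (SRTree.eval_corolla P x.2)

/-- A `2`-cell of `freeSymCat P.Wk` is an equality of values. -/
def freeSymCatWkHom {n : ℕ} {x y : (freeSymCat P.Wk).Op n}
    (h : (freeSymMap (freePlainCounit P)).app x = (freeSymMap (freePlainCounit P)).app y) :
    x ⟶ y :=
  FreeSymHom.mk (Q := P.Wk) (congrArg (fun y : (freeSym P).Op n => y.1) h)
    ⟨congrArg (fun y : (freeSym P).Op n => y.2) h⟩

-- Converse to `freeSymCatWkHom`: a 2-cell carries an equality of permutations and an equality of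
-- values in `P`.
variable {P} in
theorem freeSymCatWk_eq_of_hom {n : ℕ} {x y : (freeSymCat P.Wk).Op n} (α : x ⟶ y) :
    (freeSymMap (freePlainCounit P)).app x = (freeSymMap (freePlainCounit P)).app y :=
  Prod.ext (FreeSymHom.perm α) (FreeSymHom.hom α).down

/-- The comparison from `freeSymCat P.Wk` to `(freeSym P).Wk`. -/
def wkComparison : SymCatOperad.Hom (freeSymCat P.Wk) (freeSym P).Wk :=
  SymCatOperad.Hom.ofThin (P := freeSymCat P.Wk) (Q := (freeSym P).Wk) (signatureInclusion P)
    fun α => ⟨(counit_signatureInclusion P _).trans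
      ((freeSymCatWk_eq_of_hom α).trans (counit_signatureInclusion P _).symm)⟩

/-- The comparison from `(freeSym P).Wk` to `freeSymCat P.Wk`. -/
def wkComparisonInv : SymCatOperad.Hom (freeSym P).Wk (freeSymCat P.Wk) :=
  SymCatOperad.Hom.ofThin (P := (freeSym P).Wk) (Q := freeSymCat P.Wk) (signatureCollapse P)
    fun α => freeSymCatWkHom P ((counit_signatureCollapse P _).trans
      (α.down.trans (counit_signatureCollapse P _).symm))

theorem counit_collapse_inclusion {n : ℕ} (x : (freeSymSig P.Op).Op n) :
    (freeSymMap (freePlainCounit P)).app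
        ((signatureCollapse P).app ((signatureInclusion P).app x)) =
      (freeSymMap (freePlainCounit P)).app x :=
  (counit_signatureCollapse P _).trans (counit_signatureInclusion P x)

theorem counit_inclusion_collapse {n : ℕ} (x : (freeSymSig (freeSym P).Op).Op n) :
    (freeSymSigCounit (freeSym P)).app
        ((signatureInclusion P).app ((signatureCollapse P).app x)) =
      (freeSymSigCounit (freeSym P)).app x :=
  (counit_signatureInclusion P _).trans (counit_signatureCollapse P x)

/-- The composite of the comparisons on `freeSymCat P.Wk` is isomorphic to the identity. -/
def wkComparisonUnit :
    SymCatOperad.Hom.id (freeSymCat P.Wk) ≅ (wkComparison P).comp (wkComparisonInv P) :=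
  SymCatOperad.Hom.isoOfThin
    (fun f => freeSymCatWkHom P (counit_collapse_inclusion P f).symm)
    (fun f => freeSymCatWkHom P (counit_collapse_inclusion P f))

/-- The composite of the comparisons on `(freeSym P).Wk` is isomorphic to the identity. -/
def wkComparisonCounit :
    (wkComparisonInv P).comp (wkComparison P) ≅ SymCatOperad.Hom.id (freeSym P).Wk :=
  SymCatOperad.Hom.isoOfThin
    (fun f => ⟨counit_inclusion_collapse P f⟩)
    (fun f => ⟨(counit_inclusion_collapse P f).symm⟩)

/-- The equivalence between `freeSymCat P.Wk` and `(freeSym P).Wk`. -/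
def wkEquivalence : Bicategory.Equivalence (freeSymCat P.Wk) (freeSym P).Wk where
  hom := wkComparison P
  inv := wkComparisonInv P
  unit := wkComparisonUnit P
  counit := wkComparisonCounit P
  -- Parallel 2-cells coincide in a thin category, so the triangle law requires no computation.
  left_triangle := Iso.ext (SymCatOperad.Hom.Trans.ext' fun _ => Subsingleton.elim _ _)

end

/-! ## The number of vertices of a tree -/

/-- The operad whose operations of every arity are the natural numbers, and whose composition is
addition. -/
def additiveOperad : PlainOperad.{0} where
  Op _ := ℕ
  one := 0
  comp f g _ := f + ∑ i, g i
  one_comp f h := by simp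
  comp_one f h := by simp
  assoc {n m p k l q} f g r hm hq hp hp' := by
    have h1 : ∑ x, r ((blockEquiv k hm).symm x).1 ((blockEquiv k hm).symm x).2 =
        ∑ i, ∑ j, r i j := by
      rw [← Equiv.sum_comp (blockEquiv k hm), Fintype.sum_sigma]
      exact Finset.sum_congr rfl fun i _ => Finset.sum_congr rfl fun j _ =>
        congrArg (fun y : Σ i, Fin (k i) => r y.1 y.2) (Equiv.symm_apply_apply _ _)
    rw [h1, Finset.sum_add_distrib, add_assoc]

namespace SRTree

variable {Φ : ℕ → Type u}

/-- The number of vertices of a tree. -/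
def size {n : ℕ} (t : SRTree Φ n) : ℕ := lift additiveOperad (fun _ => (1 : ℕ)) t

theorem size_corolla {n : ℕ} (x : Φ n) : size (corolla x) = 1 :=
  lift_corolla additiveOperad _ x

theorem size_node {n m : ℕ} (x : Φ n) (k : Fin n → ℕ) (t : ∀ i, SRTree Φ (k i))
    (h : ∑ i, k i = m) : size (node x k t h) = 1 + ∑ i, size (t i) := rfl

/-- Counting vertices is a lift to `additiveOperad`, whose composition is addition, so this is an
instance of `lift_graft`. -/
theorem size_graft {n m : ℕ} {k : Fin n → ℕ} (f : SRTree Φ n) (g : ∀ i, SRTree Φ (k i))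
    (h : ∑ i, k i = m) : size (graft f g h) = size f + ∑ i, size (g i) :=
  lift_graft additiveOperad _ f g h

/-- A node contributes at least one vertex. The equality lives in a sigma type because the arity 1
is part of the conclusion. -/
theorem eq_leaf_of_size_eq_zero {n : ℕ} (t : SRTree Φ n) (ht : size t = 0) :
    (⟨n, t⟩ : Σ a, SRTree Φ a) = ⟨1, leaf⟩ := by
  cases t with
  | leaf => rfl
  | node x k t h => rw [size_node] at ht; omega

theorem eq_corolla_of_size_eq_one {n : ℕ} (t : SRTree Φ n) (ht : size t = 1) :
    ∃ x : Φ n, t = corolla x := by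
  cases t with
  | leaf => exact absurd ht zero_ne_one
  | @node n _ x k t h =>
    rw [size_node, add_eq_left, Finset.sum_eq_zero_iff] at ht
    -- The root is the only vertex, so every subtree is a leaf; then the arity of the tree is that
    -- of its root.
    have h1 := fun i => eq_leaf_of_size_eq_zero (t i) (ht i (Finset.mem_univ i))
    have h2 : ∑ i, k i = n := by
      rw [Finset.sum_congr rfl fun i _ => congrArg Sigma.fst (h1 i)]
      simp
    obtain rfl := h2.symm.trans h
    exact ⟨x, node_congr x h1 _ _⟩

theorem corolla_ne_leaf (x : Φ 1) : corolla x ≠ leaf := fun h =>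
  one_ne_zero ((size_corolla x).symm.trans (congrArg size h))

theorem corolla_injective {n : ℕ} : Function.Injective (corolla : Φ n → SRTree Φ n) :=
  fun x y h => by
    simpa [corolla] using h

end SRTree

/-! ### Vertices and generators in free symmetric operads -/

section

variable {Φ Ψ : ℕ → Type u}

/-- The number of vertices of an operation of a free symmetric operad. -/
def freeSymSigSize {n : ℕ} (x : (freeSymSig Φ).Op n) : ℕ :=
  SRTree.size (Prod.snd (show Equiv.Perm (Fin n) × SRTree Φ n from x))

theorem freeSymSigSize_comp {n m : ℕ} {k : Fin n → ℕ} (f : (freeSymSig Φ).Op n)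
    (g : ∀ i, (freeSymSig Φ).Op (k i)) (h : ∑ i, k i = m) :
    freeSymSigSize ((freeSymSig Φ).comp f g h) =
      freeSymSigSize f + ∑ i, freeSymSigSize (g i) := by
  obtain ⟨σ, f⟩ := f
  refine (SRTree.size_graft f _ _).trans (congrArg (fun y => SRTree.size f + y) ?_)
  -- Input `i` of the tree receives `g (σ i)`, and the sum does not depend on this reordering.
  exact Equiv.sum_comp σ fun i => freeSymSigSize (g i)

theorem eq_one_of_freeSymSigSize_eq_zero {n : ℕ} (x : (freeSymSig Φ).Op n)
    (hx : freeSymSigSize x = 0) : (⟨n, x⟩ : Σ a, (freeSymSig Φ).Op a) = ⟨1, (freeSymSig Φ).one⟩ := by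
  obtain ⟨σ, t⟩ := x
  have h1 := SRTree.eq_leaf_of_size_eq_zero t hx
  obtain rfl : n = 1 := congrArg Sigma.fst h1
  obtain rfl : t = SRTree.leaf := eq_of_heq (Sigma.mk.inj_iff.1 h1).2
  exact congrArg (Sigma.mk 1) (Prod.ext (Subsingleton.elim _ _) rfl)

/-- An operation without vertices is the identity, so injectivity would make the generator itself
equal to the identity, but a corolla is not a leaf. -/
theorem one_le_freeSymSigSize_gen (e : SymOperad.Hom (freeSymSig Φ) (freeSymSig Ψ))
    (he : ∀ n, Function.Injective (e.app (n := n))) {n : ℕ} (x : Φ n) :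
    1 ≤ freeSymSigSize (e.app (freeSymSigGen x)) := by
  by_contra h
  have h1 := eq_one_of_freeSymSigSize_eq_zero (e.app (freeSymSigGen x)) (by omega)
  obtain rfl : n = 1 := congrArg Sigma.fst h1
  have h2 : e.app (freeSymSigGen x) = e.app (freeSymSig Φ).one :=
    Eq.trans (by simpa using h1) e.app_one.symm
  exact SRTree.corolla_ne_leaf x (congrArg (fun y : (freeSymSig Φ).Op 1 => y.2) (he 1 h2))

/-- An injective morphism of free symmetric operads does not decrease the number of vertices. -/
theorem freeSymSigSize_le (e : SymOperad.Hom (freeSymSig Φ) (freeSymSig Ψ))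
    (he : ∀ n, Function.Injective (e.app (n := n))) {n : ℕ} (x : (freeSymSig Φ).Op n) :
    freeSymSigSize x ≤ freeSymSigSize (e.app x) := by
  obtain ⟨σ, t⟩ := x
  let ψ := (freeSymUnit (freePlain Φ)).comp e.toHom
  have h1 : e.app (n := n) (σ, t) = (freeSymSig Ψ).act σ (ψ.app t) :=
    e.app_act σ ((freeSymUnit (freePlain Φ)).app t)
  rw [h1]
  -- Acting by `σ` changes only the permutation, hence not the number of vertices.
  change SRTree.size t ≤ freeSymSigSize (ψ.app t)
  refine freePlain_induction (motive := fun {n} t => SRTree.size t ≤ freeSymSigSize (ψ.app t))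
    (Nat.zero_le _) (fun {n m k} x t h ih => ?_) t
  -- Sizes add up on both sides of the composite; the root counts 1 in the source, and its image
  -- counts at least 1.
  have h2 := (congrArg freeSymSigSize (ψ.app_comp (SRTree.corolla x) t h)).trans
    (freeSymSigSize_comp _ _ _)
  refine le_of_le_of_eq ?_ h2.symm
  refine le_of_eq_of_le (SRTree.size_graft _ t h) (add_le_add ?_ (Finset.sum_le_sum fun i _ => ih i))
  rw [SRTree.size_corolla]
  exact one_le_freeSymSigSize_gen e he x

/-- An operation with a single vertex is a permuted corolla, and only one label is available for
that corolla. -/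
theorem exists_act_of_freeSymSigSize_eq_one {n : ℕ} [Subsingleton (Φ n)]
    {x y : (freeSymSig Φ).Op n} (hx : freeSymSigSize x = 1) (hy : freeSymSigSize y = 1) :
    ∃ σ, y = (freeSymSig Φ).act σ x := by
  obtain ⟨σ, t⟩ := x
  obtain ⟨τ, s⟩ := y
  obtain ⟨a, rfl⟩ := SRTree.eq_corolla_of_size_eq_one t hx
  obtain ⟨b, rfl⟩ := SRTree.eq_corolla_of_size_eq_one s hy
  obtain rfl := Subsingleton.elim a b
  exact ⟨τ * σ⁻¹, Prod.ext (inv_mul_cancel_right τ σ).symm rfl⟩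

/-- If the free symmetric operads on `Φ` and `Ψ` are isomorphic and `Φ` has at most one symbol of
arity `n`, then so has `Ψ`. -/
theorem subsingleton_of_freeSymSig_iso (e : SymOperad.Hom (freeSymSig Φ) (freeSymSig Ψ))
    (e' : SymOperad.Hom (freeSymSig Ψ) (freeSymSig Φ))
    (h : ∀ {n : ℕ} (x : (freeSymSig Φ).Op n), e'.app (e.app x) = x)
    (h' : ∀ {n : ℕ} (x : (freeSymSig Ψ).Op n), e.app (e'.app x) = x) (n : ℕ)
    [Subsingleton (Φ n)] : Subsingleton (Ψ n) := by
  -- Since `e` does not decrease sizes and sends `e'.app (freeSymSigGen x)` back to a generator,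
  -- that element has size at most 1; injectivity of `e'` gives the other bound.
  have hs : ∀ x : Ψ n, freeSymSigSize (e'.app (freeSymSigGen x)) = 1 := fun x => by
    have h1 := freeSymSigSize_le e (fun _ => Function.LeftInverse.injective h)
      (e'.app (freeSymSigGen x))
    rw [h', show freeSymSigSize (freeSymSigGen x) = 1 from SRTree.size_corolla x] at h1
    exact le_antisymm h1
      (one_le_freeSymSigSize_gen e' (fun _ => Function.LeftInverse.injective h') x)
  refine ⟨fun a b => ?_⟩
  obtain ⟨σ, hσ⟩ := exists_act_of_freeSymSigSize_eq_one (hs a) (hs b)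
  -- Transporting back along `e`, the two generators differ by a permutation, which leaves the
  -- underlying corolla unchanged.
  have h1 : (freeSymSigGen b : (freeSymSig Ψ).Op n) =
      (freeSymSig Ψ).act σ (freeSymSigGen a) := by
    rw [← h' (freeSymSigGen b), hσ, e.app_act, h']
  exact (SRTree.corolla_injective
    (congrArg (fun y : (freeSymSig Ψ).Op n => y.2) h1)).symm

end

/-! ### Non-isomorphism for the terminal operad -/

/-- The underlying morphism of symmetric operads of a morphism of symmetric `Cat`-operads. -/
def SymCatOperad.Hom.toSymHom {P Q : SymCatOperad.{u, v}} (F : SymCatOperad.Hom P Q) :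
    SymOperad.Hom P.toSymOperad Q.toSymOperad where
  app f := F.app f
  app_one := F.app_one
  app_comp := F.app_comp
  app_act := F.app_act

/-- The plain operad with one operation of every arity. -/
def terminalPlainOperad : PlainOperad.{u} where
  Op _ := PUnit
  one := PUnit.unit
  comp _ _ _ := PUnit.unit
  one_comp _ _ := rfl
  comp_one _ _ := rfl
  assoc _ _ _ _ _ _ _ := rfl

/-- In arity 2 the terminal operad has one operation, whereas its free symmetric operad has two, one
for each permutation. These are the generators of the 1-cells on the two sides. -/
theorem isEmpty_iso_wk_terminal :
    IsEmpty (freeSymCat terminalPlainOperad.{u}.Wk ≅ (freeSym terminalPlainOperad.{u}).Wk) := by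
  refine ⟨fun i => ?_⟩
  let F : SymCatOperad.Hom (freeSymCat terminalPlainOperad.{u}.Wk)
    (freeSym terminalPlainOperad.{u}).Wk := i.hom
  let G : SymCatOperad.Hom (freeSym terminalPlainOperad.{u}).Wk
    (freeSymCat terminalPlainOperad.{u}.Wk) := i.inv
  have h1 : F.comp G = SymCatOperad.Hom.id _ := i.hom_inv_id
  have h2 : G.comp F = SymCatOperad.Hom.id _ := i.inv_hom_id
  have : Subsingleton (terminalPlainOperad.{u}.Op 2) := inferInstanceAs (Subsingleton PUnit)
  have h3 := subsingleton_of_freeSymSig_iso (Φ := terminalPlainOperad.{u}.Op)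
    (Ψ := (freeSym terminalPlainOperad.{u}).Op) F.toSymHom G.toSymHom
    (fun {n} x => congrArg (fun H : SymCatOperad.Hom (freeSymCat terminalPlainOperad.{u}.Wk)
      (freeSymCat terminalPlainOperad.{u}.Wk) => H.app (n := n) x) h1)
    (fun {n} x => congrArg (fun H : SymCatOperad.Hom (freeSym terminalPlainOperad.{u}).Wk
      (freeSym terminalPlainOperad.{u}).Wk => H.app (n := n) x) h2) 2
  have h4 := h3.elim (Equiv.swap 0 1, PUnit.unit) (1, PUnit.unit)
  have h5 := Equiv.congr_fun
    (congrArg (fun y : (freeSym terminalPlainOperad.{u}).Op 2 => y.1) h4) 0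
  exact absurd h5 (by decide)

/-! ## Restriction of algebras along morphisms of symmetric `Cat`-operads -/

namespace PlainCatOperad.Algebra

variable {Q : PlainCatOperad.{u, v}}

/-- Reindexing arguments by block permutations gives equal but not definitionally equal objects;
this transports the action along such equalities. -/
theorem map_heq (A : Algebra.{u, v, w, z} Q) {n : ℕ} {f f' g g' : Q.Op n}
    {a a' b b' : Fin n → A.carrier} (hf : f = g) (hf' : f' = g') (ha : ∀ i, a i = b i)
    (ha' : ∀ i, a' i = b' i) {α : f ⟶ f'} {β : g ⟶ g'} (hα : HEq α β) {x : ∀ i, a i ⟶ a' i}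
    {y : ∀ i, b i ⟶ b' i} (hx : ∀ i, HEq (x i) (y i)) : HEq (A.map α x) (A.map β y) := by
  obtain rfl : a = b := funext ha
  obtain rfl : a' = b' := funext ha'
  subst hf hf' hα
  obtain rfl : x = y := funext fun i => eq_of_heq (hx i)
  rfl

theorem map_left_heq (A : Algebra.{u, v, w, z} Q) {n : ℕ} {f f' g g' : Q.Op n}
    {a a' : Fin n → A.carrier} (hf : f = g) (hf' : f' = g') {α : f ⟶ f'} {β : g ⟶ g'}
    (hα : HEq α β) (x : ∀ i, a i ⟶ a' i) : HEq (A.map α x) (A.map β x) :=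
  A.map_heq hf hf' (fun _ => rfl) (fun _ => rfl) hα fun _ => HEq.rfl

/-- Together with `map_comp_left_id`, this is the interchange of acting by a 2-cell and acting by
morphisms of arguments. -/
theorem map_comp_right_id (A : Algebra.{u, v, w, z} Q) {n : ℕ} {f f' f'' : Q.Op n}
    {a a' : Fin n → A.carrier} (α : f ⟶ f') (α' : f' ⟶ f'') (x : ∀ i, a i ⟶ a' i) :
    A.map (α ≫ α') x = A.map α x ≫ A.map α' (fun i => 𝟙 (a' i)) := by
  rw [← A.map_comp]
  simp only [Category.comp_id]

theorem map_comp_left_id (A : Algebra.{u, v, w, z} Q) {n : ℕ} {f f' f'' : Q.Op n}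
    {a a' : Fin n → A.carrier} (α : f ⟶ f') (α' : f' ⟶ f'') (x : ∀ i, a i ⟶ a' i) :
    A.map (α ≫ α') x = A.map α (fun i => 𝟙 (a i)) ≫ A.map α' x := by
  rw [← A.map_comp]
  simp only [Category.id_comp]

theorem WeakHom.coh_heq {A B : Algebra.{u, v, w, z} Q} (F : WeakHom A B) {n : ℕ} {f g : Q.Op n}
    {a b : Fin n → A.carrier} (hf : f = g) (ha : ∀ i, a i = b i) :
    HEq (F.coh f a).hom (F.coh g b).hom := by
  obtain rfl : a = b := funext ha
  subst hf
  rfl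

theorem WeakHom.naturality_left {A B : Algebra.{u, v, w, z} Q} (F : WeakHom A B) {n : ℕ}
    {f f' : Q.Op n} (α : f ⟶ f') (a : Fin n → A.carrier) :
    B.map α (fun i => 𝟙 (F.functor.obj (a i))) ≫ (F.coh f' a).hom =
      (F.coh f a).hom ≫ F.functor.map (A.map α fun i => 𝟙 (a i)) :=
  (congrArg (fun y => B.map α y ≫ (F.coh f' a).hom)
    (funext fun i => (F.functor.map_id (a i)).symm)).trans (F.naturality α fun i => 𝟙 (a i))

/-- The 2-naturality conditions in `TwoEquivalence` relate 2-cells whose boundaries are only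
propositionally equal; this reduces them to components. -/
theorem WeakHom.Trans.heq_of_app {A B : Algebra.{u, v, w, z} Q} {F F' G G' : WeakHom A B}
    (hF : F = F') (hG : G = G') {η : Trans F G} {η' : Trans F' G'}
    (h : ∀ a, HEq (η.nat.app a) (η'.nat.app a)) : HEq η η' := by
  subst hF hG
  exact heq_of_eq (ext' fun a => eq_of_heq (h a))

end PlainCatOperad.Algebra

namespace SymCatOperad.Algebra

variable {Q R : SymCatOperad.{u, v}}

theorem WeakHom.eq_of_coh {A B : Algebra.{u, v, w, z} Q} {F G : WeakHom A B}
    (h : F.functor = G.functor)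
    (hc : ∀ {n : ℕ} (f : Q.Op n) (a : Fin n → A.carrier), HEq (F.coh f a).hom (G.coh f a).hom) :
    F = G :=
  WeakHom.ext' (PlainCatOperad.Algebra.WeakHom.ext' h hc)

theorem WeakHom.trans_heq_of_app {A B : Algebra.{u, v, w, z} Q} {F F' G G' : WeakHom A B}
    (hF : F = F') (hG : G = G')
    {η : PlainCatOperad.Algebra.WeakHom.Trans F.toWeakHom G.toWeakHom}
    {η' : PlainCatOperad.Algebra.WeakHom.Trans F'.toWeakHom G'.toWeakHom}
    (h : ∀ a, HEq (η.nat.app a) (η'.nat.app a)) : HEq η η' :=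
  PlainCatOperad.Algebra.WeakHom.Trans.heq_of_app (congrArg WeakHom.toWeakHom hF)
    (congrArg WeakHom.toWeakHom hG) h

/-- Restriction of an algebra along a morphism of symmetric `Cat`-operads. -/
def restrict (φ : Hom Q R) (A : Algebra.{u, v, w, z} R) : Algebra.{u, v, w, z} Q where
  carrier := A.carrier
  obj f a := A.obj (φ.app f) a
  map α x := A.map (φ.map α) x
  map_id f a := by rw [φ.map_id, A.map_id]
  map_comp α α' x x' := by rw [φ.map_comp, A.map_comp]
  obj_one a := by rw [φ.app_one, A.obj_one]
  map_one x := by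
    rw [φ.map_id]
    exact (A.map_left_heq φ.app_one φ.app_one (heq_id_of_eq φ.app_one) x).trans (A.map_one x)
  obj_opComp f g h a := by rw [φ.app_comp, A.obj_opComp]
  map_compMap α β h x :=
    (A.map_left_heq (φ.app_comp _ _ h) (φ.app_comp _ _ h) (φ.map_compMap α β h) x).trans
      (A.map_compMap (φ.map α) (fun i => φ.map (β i)) h x)
  obj_act σ f a := by rw [φ.app_act, A.obj_act]
  map_actMap σ _ _ _ _ α x :=
    (A.map_left_heq (φ.app_act σ _) (φ.app_act σ _) (φ.map_actMap σ α) x).trans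
      (A.map_actMap σ (φ.map α) x)

/-- Restriction of a weak morphism along a morphism of symmetric `Cat`-operads. -/
def WeakHom.restrict (φ : Hom Q R) {A B : Algebra.{u, v, w, z} R} (F : WeakHom A B) :
    WeakHom (A.restrict φ) (B.restrict φ) where
  functor := F.functor
  coh f a := F.coh (φ.app f) a
  naturality α x := F.naturality (φ.map α) x
  coh_one a := (F.coh_heq φ.app_one fun _ => rfl).trans (F.coh_one a)
  coh_comp f g h a := by
    change HEq _ (B.map (φ.map (𝟙 f)) _ ≫ _)
    rw [φ.map_id]
    exact (F.coh_heq (φ.app_comp f g h) fun _ => rfl).trans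
      (F.coh_comp (φ.app f) (fun i => φ.app (g i)) h a)
  coh_act σ f a :=
    (F.coh_heq (φ.app_act σ f) fun _ => rfl).trans (F.coh_act σ (φ.app f) a)

/-- Restriction of a transformation along a morphism of symmetric `Cat`-operads. -/
def WeakHom.restrictTrans (φ : Hom Q R) {A B : Algebra.{u, v, w, z} R} {F G : WeakHom A B}
    (η : PlainCatOperad.Algebra.WeakHom.Trans F.toWeakHom G.toWeakHom) :
    PlainCatOperad.Algebra.WeakHom.Trans (F.restrict φ).toWeakHom (G.restrict φ).toWeakHom where
  nat := η.nat
  comm f a := by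
    change B.map (φ.map (𝟙 f)) _ ≫ _ = _
    rw [φ.map_id]
    exact η.comm (φ.app f) a

/-- Restriction of algebras along a morphism of symmetric `Cat`-operads, as a strict
`2`-functor. -/
def restrictFunctor (φ : Hom Q R) :
    StrictPseudofunctor (Algebra.{u, v, w, z} R) (Algebra.{u, v, w, z} Q) :=
  StrictPseudofunctor.mk''
    { obj := fun A => A.restrict φ
      map := fun F => WeakHom.restrict φ F
      map₂ := fun η => WeakHom.restrictTrans φ η
      map₂_id := fun _ => rfl
      map₂_comp := fun _ _ => rfl
      map_id := fun _ => rfl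
      map_comp := fun _ _ => rfl
      -- Restriction preserves composition definitionally, so the comparison 2-cells are identities.
      map₂_whisker_left := fun _ _ _ _ => PlainCatOperad.Algebra.WeakHom.Trans.ext' fun _ =>
        PlainCatOperad.Algebra.WeakHom.conj_id rfl rfl _
      map₂_whisker_right := fun _ _ => PlainCatOperad.Algebra.WeakHom.Trans.ext' fun _ =>
        PlainCatOperad.Algebra.WeakHom.conj_id rfl rfl _ }

/-- The weak morphism between the restrictions of an algebra along two isomorphic morphisms. -/
def restrictComparison {φ ψ : Hom Q R} (θ : φ ≅ ψ) (A : Algebra.{u, v, w, z} R) :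
    WeakHom (A.restrict ψ) (A.restrict φ) where
  functor := 𝟭 A.carrier
  -- A coherence map goes from the operation of the target algebra to that of the source, so `θ.hom
  -- : φ ⟶ ψ` yields a morphism from the restriction along `ψ` to the one along `φ`.
  coh f a :=
    { hom := A.map (θ.hom.app f) (fun i => 𝟙 (a i))
      inv := A.map (θ.inv.app f) (fun i => 𝟙 (a i))
      hom_inv_id := by
        have h1 : θ.hom.app f ≫ θ.inv.app f = 𝟙 _ :=
          congrArg (fun η : Hom.Trans φ φ => η.app f) θ.hom_inv_id
        refine (A.map_comp_right_id (θ.hom.app f) (θ.inv.app f) fun i => 𝟙 (a i)).symm.trans ?_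
        rw [h1]
        exact A.map_id _ _
      inv_hom_id := by
        have h1 : θ.inv.app f ≫ θ.hom.app f = 𝟙 _ :=
          congrArg (fun η : Hom.Trans ψ ψ => η.app f) θ.inv_hom_id
        refine (A.map_comp_right_id (θ.inv.app f) (θ.hom.app f) fun i => 𝟙 (a i)).symm.trans ?_
        rw [h1]
        exact A.map_id _ _ }
  naturality {n f f' a a'} α x := by
    -- Both sides are the action of one 2-cell, factored in the two ways related by naturality of
    -- `θ.hom`.
    have h1 := A.map_comp_right_id (φ.map α) (θ.hom.app f') x
    rw [θ.hom.naturality] at h1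
    exact h1.symm.trans (A.map_comp_left_id (θ.hom.app f) (ψ.map α) x)
  coh_one a :=
    (A.map_left_heq φ.app_one ψ.app_one θ.hom.app_one fun i => 𝟙 (a i)).trans (A.map_one _)
  coh_comp f g h a := by
    refine ((A.map_left_heq (φ.app_comp f g h) (ψ.app_comp f g h) (θ.hom.app_comp f g h)
      fun i => 𝟙 (a i)).trans (A.map_compMap (θ.hom.app f) (fun i => θ.hom.app (g i)) h
        fun i => 𝟙 (a i))).trans (heq_of_eq ?_)
    -- Functoriality separates the inner cells `θ.hom.app (g i)`, taken under the identity of `φ.app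
    -- f`, from the outer cell `θ.hom.app f`: these are the two factors in the composition law.
    have h1 := A.map_comp (φ.map (𝟙 f)) (θ.hom.app f)
      (fun i => A.map (θ.hom.app (g i)) (fun j => 𝟙 (a (blockEquiv _ h ⟨i, j⟩))))
      (fun i => 𝟙 (A.obj (ψ.app (g i)) (fun j => a (blockEquiv _ h ⟨i, j⟩))))
    simp only [Category.comp_id] at h1
    refine Eq.trans ?_ h1
    rw [φ.map_id, Category.id_comp]
  coh_act σ f a :=
    (A.map_left_heq (φ.app_act σ f) (ψ.app_act σ f) (θ.hom.app_act σ f) fun i => 𝟙 (a i)).trans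
      (A.map_actMap σ (θ.hom.app f) fun i => 𝟙 (a i))

/-- The coherence maps of the composite are those of `θ.inv` followed by those of `θ.hom`, and they
cancel. The comparisons are thus inverse strictly, not just up to a 2-cell. -/
theorem restrictComparison_comp {φ ψ : Hom Q R} (θ : φ ≅ ψ) (A : Algebra.{u, v, w, z} R) :
    (restrictComparison θ A).comp (restrictComparison θ.symm A) = WeakHom.id (A.restrict ψ) :=
  WeakHom.eq_of_coh rfl fun f a =>
    heq_of_eq (((restrictComparison θ.symm A).coh f a).hom_inv_id)

/-- The underlying functors agree, and equality of the coherence maps is naturality of those of `F`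
along the 2-cell `θ.hom.app f`. -/
theorem restrictComparison_naturality {φ ψ : Hom Q R} (θ : φ ≅ ψ) {A B : Algebra.{u, v, w, z} R}
    (F : WeakHom A B) :
    (F.restrict ψ).comp (restrictComparison θ B) =
      (restrictComparison θ A).comp (F.restrict φ) :=
  WeakHom.eq_of_coh rfl fun f a => heq_of_eq (F.naturality_left (θ.hom.app f) a)

/-- Isomorphic morphisms induce isomorphic restrictions. -/
def restrictIso {φ ψ : Hom Q R} (θ : φ ≅ ψ) (A : Algebra.{u, v, w, z} R) :
    A.restrict ψ ≅ A.restrict φ where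
  hom := restrictComparison θ A
  inv := restrictComparison θ.symm A
  hom_inv_id := restrictComparison_comp θ A
  inv_hom_id := restrictComparison_comp θ.symm A

/-- An equivalence between symmetric `Cat`-operads induces an equivalence between the `2`-categories
of algebras. -/
def restrictEquivalence (e : Bicategory.Equivalence Q R) :
    TwoEquivalence (Algebra.{u, v, w, z} Q) (Algebra.{u, v, w, z} R) where
  functor := restrictFunctor e.inv
  inverse := restrictFunctor e.hom
  unitIso := NatIso.ofComponents
    -- Restricting twice is definitionally restriction along the composite. The symmetric of
    -- `e.unit` appears because `restrictIso` reverses direction.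
    (fun A => restrictIso (φ := Hom.comp e.hom e.inv) (ψ := Hom.id Q) e.unit.symm A)
    (fun F => restrictComparison_naturality (φ := Hom.comp e.hom e.inv) (ψ := Hom.id Q)
      e.unit.symm F)
  counitIso := NatIso.ofComponents
    (fun A => restrictIso (φ := Hom.id R) (ψ := Hom.comp e.inv e.hom) e.counit.symm A)
    (fun F => restrictComparison_naturality (φ := Hom.id R) (ψ := Hom.comp e.inv e.hom)
      e.counit.symm F)
  unit_naturality {A B F G} η := WeakHom.trans_heq_of_app
    (restrictComparison_naturality (φ := Hom.comp e.hom e.inv) (ψ := Hom.id Q) e.unit.symm F)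
    (restrictComparison_naturality (φ := Hom.comp e.hom e.inv) (ψ := Hom.id Q) e.unit.symm G)
    fun _ => HEq.rfl
  counit_naturality {A B F G} η := WeakHom.trans_heq_of_app
    (restrictComparison_naturality (φ := Hom.id R) (ψ := Hom.comp e.inv e.hom) e.counit.symm F)
    (restrictComparison_naturality (φ := Hom.id R) (ψ := Hom.comp e.inv e.hom) e.counit.symm G)
    fun _ => HEq.rfl

end SymCatOperad.Algebra

/-! ## Algebras for the free symmetric `Cat`-operad on a plain `Cat`-operad -/

section

variable {Q : PlainCatOperad.{u, v}}

namespace PlainCatOperad.Algebra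

/-- The action on morphisms of the algebra `A.freeSym`. -/
def freeSymMapHom (A : Algebra.{u, v, w, z} Q) {n : ℕ} {σ σ' : Equiv.Perm (Fin n)} (hσ : σ = σ')
    {p p' : Q.Op n} {a a' : Fin n → A.carrier} (α : p ⟶ p') (x : ∀ i, a i ⟶ a' i) :
    A.obj p (fun i => a (σ i)) ⟶ A.obj p' (fun i => a' (σ' i)) :=
  match σ', hσ with
  | _, rfl => A.map α fun i => x (σ i)

/-- An algebra for `Q`, regarded as an algebra for the free symmetric `Cat`-operad on `Q`. -/
def freeSym (A : Algebra.{u, v, w, z} Q) : SymCatOperad.Algebra.{u, v, w, z} (freeSymCat Q) where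
  carrier := A.carrier
  obj x a := A.obj x.2 (fun i => a (x.1 i))
  map α x := A.freeSymMapHom (FreeSymHom.perm α) (FreeSymHom.hom α) x
  map_id f a := A.map_id f.2 _
  map_comp := by
    rintro n ⟨σ, f⟩ ⟨_, f'⟩ ⟨_, f''⟩ a a' a'' ⟨h₁, α⟩ ⟨h₂, α'⟩ x x'
    cases h₁
    cases h₂
    exact A.map_comp α α' _ _
  obj_one a := A.obj_one a
  map_one x := A.map_one x
  obj_opComp {n m k} f g h a := by
    refine (A.obj_opComp f.2 (fun i => (g (f.1 i)).2) (sum_comp_perm f.1 h) _).trans ?_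
    refine congrArg (A.obj f.2) (funext fun i => congrArg (A.obj _) (funext fun j => ?_))
    -- Applying the block permutation to all arguments amounts to permuting the blocks and then the
    -- entries inside each block.
    exact congrArg a (blockPerm_blockEquiv f.1 (fun i => (g i).1) h i j)
  map_compMap := by
    rintro n m k ⟨σ, f⟩ ⟨_, f'⟩ g g' a a' ⟨h₁, α⟩ β h x
    cases h₁
    -- The pairs are split into permutations and operations so that the equality of permutations
    -- carried by the 2-cells can be eliminated.
    obtain ⟨τ, g, rfl⟩ : ∃ τ g₀, g = fun i => (τ i, g₀ i) :=
      ⟨fun i => (g i).1, fun i => (g i).2, rfl⟩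
    obtain ⟨τ', g', rfl⟩ : ∃ τ g₀, g' = fun i => (τ i, g₀ i) :=
      ⟨fun i => (g' i).1, fun i => (g' i).2, rfl⟩
    obtain rfl : τ = τ' := funext fun i => (β i).perm
    obtain ⟨β, rfl⟩ : ∃ β₀ : ∀ i, g i ⟶ g' i, β = fun i => ⟨rfl, β₀ i⟩ :=
      ⟨fun i => (β i).hom, rfl⟩
    have h1 := fun i j => blockPerm_blockEquiv σ τ h i j
    refine (A.map_compMap α (fun i => β (σ i)) (sum_comp_perm σ h)
      (fun i => x (blockPerm σ τ h i))).trans ?_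
    refine A.map_heq rfl rfl
      (fun i => congrArg (A.obj _) (funext fun j => congrArg a (h1 i j)))
      (fun i => congrArg (A.obj _) (funext fun j => congrArg a' (h1 i j))) HEq.rfl fun i => ?_
    refine A.map_heq rfl rfl (fun j => congrArg a (h1 i j)) (fun j => congrArg a' (h1 i j))
      HEq.rfl fun j => ?_
    rw [h1]
  obj_act σ f a := rfl
  map_actMap := by
    rintro n ρ ⟨σ, f⟩ ⟨_, f'⟩ a a' ⟨h₁, α⟩ x
    cases h₁
    exact HEq.rfl

/-- A weak morphism of algebras for `Q`, regarded as a weak morphism of algebras for the free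
symmetric `Cat`-operad on `Q`. -/
def WeakHom.freeSym {A B : Algebra.{u, v, w, z} Q} (F : WeakHom A B) :
    SymCatOperad.Algebra.WeakHom A.freeSym B.freeSym where
  functor := F.functor
  coh x a := F.coh x.2 (fun i => a (x.1 i))
  naturality := by
    rintro n ⟨σ, f⟩ ⟨_, f'⟩ a a' ⟨h₁, α⟩ x
    cases h₁
    exact F.naturality α fun i => x (σ i)
  coh_one a := F.coh_one a
  coh_comp {n m k} f g h a := by
    have h1 := fun i j => blockPerm_blockEquiv f.1 (fun i => (g i).1) h i j
    have h2 := fun i => congrArg (A.obj (g (f.1 i)).2) (funext fun j => congrArg a (h1 i j))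
    have h3 := fun i => congrArg (B.obj (g (f.1 i)).2)
      (funext fun j => congrArg F.functor.obj (congrArg a (h1 i j)))
    refine (F.coh_comp f.2 (fun i => (g (f.1 i)).2) (sum_comp_perm f.1 h) _).trans ?_
    refine heq_comp_of_eq (congrArg (B.obj f.2) (funext h3))
      (congrArg (B.obj f.2) (funext fun i => congrArg F.functor.obj (h2 i)))
      (congrArg F.functor.obj (congrArg (A.obj f.2) (funext h2))) ?_ (F.coh_heq rfl h2)
    exact B.map_heq rfl rfl h3 (fun i => congrArg F.functor.obj (h2 i)) HEq.rfl
      fun i => F.coh_heq rfl fun j => congrArg a (h1 i j)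
  coh_act σ f a := HEq.rfl

/-- A transformation between weak morphisms of algebras for `Q`, regarded as a transformation
between weak morphisms of algebras for the free symmetric `Cat`-operad on `Q`. -/
def WeakHom.freeSymTrans {A B : Algebra.{u, v, w, z} Q} {F G : WeakHom A B} (η : Trans F G) :
    Trans F.freeSym.toWeakHom G.freeSym.toWeakHom where
  nat := η.nat
  comm f a := η.comm f.2 fun i => a (f.1 i)

/-- The strict `2`-functor from algebras for `Q` to algebras for the free symmetric `Cat`-operad on
`Q`. -/
def freeSymFunctor (Q : PlainCatOperad.{u, v}) : StrictPseudofunctor (Algebra.{u, v, w, z} Q)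
    (SymCatOperad.Algebra.{u, v, w, z} (freeSymCat Q)) :=
  StrictPseudofunctor.mk''
    { obj := fun A => A.freeSym
      map := fun F => WeakHom.freeSym F
      map₂ := fun η => WeakHom.freeSymTrans η
      map₂_id := fun _ => rfl
      map₂_comp := fun _ _ => rfl
      map_id := fun _ => rfl
      map_comp := fun _ _ => rfl
      map₂_whisker_left := fun _ _ _ _ => WeakHom.Trans.ext' fun _ =>
        WeakHom.conj_id rfl rfl _
      map₂_whisker_right := fun _ _ => WeakHom.Trans.ext' fun _ =>
        WeakHom.conj_id rfl rfl _ }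

end PlainCatOperad.Algebra

/-! ### Underlying plain algebras -/

namespace SymCatOperad.Algebra

/-- An operation of `Q`, regarded as an operation of the free symmetric `Cat`-operad on `Q`. -/
def freeSymCatUnit {n : ℕ} (f : Q.Op n) : (freeSymCat Q).Op n := (1, f)

/-- The block permutation assembled from identities is the identity, but not by definition;
`toPlain` therefore transports along this equation. -/
theorem freeSymCatUnit_comp {n m : ℕ} {k : Fin n → ℕ} (f : Q.Op n) (g : ∀ i, Q.Op (k i))
    (h : ∑ i, k i = m) : freeSymCatUnit (Q.comp f g h) =
      (freeSymCat Q).comp (freeSymCatUnit f) (fun i => freeSymCatUnit (g i)) h :=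
  (freeSymUnit Q.toPlainOperad).app_comp f g h

/-- A `2`-cell of `Q`, regarded as a `2`-cell of the free symmetric `Cat`-operad on `Q`. -/
def freeSymCatUnitHom {n : ℕ} {f f' : Q.Op n} (α : f ⟶ f') :
    freeSymCatUnit f ⟶ freeSymCatUnit f' :=
  FreeSymHom.mk (Q := Q) (x := (1, f)) (y := (1, f')) rfl α

theorem freeSymCatUnitHom_compMap {n m : ℕ} {k : Fin n → ℕ} {f f' : Q.Op n}
    {g g' : ∀ i, Q.Op (k i)} (α : f ⟶ f') (β : ∀ i, g i ⟶ g' i) (h : ∑ i, k i = m) :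
    HEq (freeSymCatUnitHom (Q.compMap α β h))
      ((freeSymCat Q).compMap (freeSymCatUnitHom α) (fun i => freeSymCatUnitHom (β i)) h) :=
  FreeSymHom.heq_ext (freeSymCatUnit_comp f g h) (freeSymCatUnit_comp f' g' h) HEq.rfl

/-- The algebra for `Q` that underlies an algebra for the free symmetric `Cat`-operad on `Q`. -/
def toPlain (A : Algebra.{u, v, w, z} (freeSymCat Q)) :
    PlainCatOperad.Algebra.{u, v, w, z} Q where
  carrier := A.carrier
  obj {n} f a := A.obj (freeSymCatUnit f) a
  map α x := A.map (freeSymCatUnitHom α) x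
  map_id f a := A.map_id _ a
  map_comp α α' x x' := A.map_comp (freeSymCatUnitHom α) (freeSymCatUnitHom α') x x'
  obj_one a := A.obj_one a
  map_one x := A.map_one x
  obj_opComp f g h a := by
    rw [freeSymCatUnit_comp f g h]
    exact A.obj_opComp _ _ h a
  map_compMap {n m k f f' g g' a a'} α β h x :=
    (A.map_left_heq (freeSymCatUnit_comp f g h) (freeSymCatUnit_comp f' g' h)
      (freeSymCatUnitHom_compMap α β h) x).trans
      (A.map_compMap (freeSymCatUnitHom α) (fun i => freeSymCatUnitHom (β i)) h x)

/-- The weak morphism of algebras for `Q` that underlies a weak morphism of algebras for the free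
symmetric `Cat`-operad on `Q`. -/
def WeakHom.toPlain {A B : Algebra.{u, v, w, z} (freeSymCat Q)} (F : WeakHom A B) :
    PlainCatOperad.Algebra.WeakHom A.toPlain B.toPlain where
  functor := F.functor
  coh {n} f a := F.coh (freeSymCatUnit f) a
  naturality α x := F.naturality (freeSymCatUnitHom α) x
  coh_one a := F.coh_one a
  coh_comp f g h a :=
    (F.coh_heq (freeSymCatUnit_comp f g h) fun _ => rfl).trans (F.coh_comp _ _ h a)

/-- The transformation that underlies a transformation between weak morphisms of algebras for the
free symmetric `Cat`-operad on `Q`. -/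
def WeakHom.toPlainTrans {A B : Algebra.{u, v, w, z} (freeSymCat Q)} {F G : WeakHom A B}
    (η : PlainCatOperad.Algebra.WeakHom.Trans F.toWeakHom G.toWeakHom) :
    PlainCatOperad.Algebra.WeakHom.Trans F.toPlain G.toPlain where
  nat := η.nat
  comm {n} f a := η.comm (freeSymCatUnit f) a

/-- The strict `2`-functor from algebras for the free symmetric `Cat`-operad on `Q` to algebras for
`Q`. -/
def toPlainFunctor (Q : PlainCatOperad.{u, v}) :
    StrictPseudofunctor (Algebra.{u, v, w, z} (freeSymCat Q))
      (PlainCatOperad.Algebra.{u, v, w, z} Q) :=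
  StrictPseudofunctor.mk''
    { obj := fun A => toPlain A
      map := fun F => WeakHom.toPlain F
      map₂ := fun η => WeakHom.toPlainTrans η
      map₂_id := fun _ => rfl
      map₂_comp := fun _ _ => rfl
      map_id := fun _ => rfl
      map_comp := fun _ _ => rfl
      map₂_whisker_left := fun _ _ _ _ => PlainCatOperad.Algebra.WeakHom.Trans.ext' fun _ =>
        PlainCatOperad.Algebra.WeakHom.conj_id rfl rfl _
      map₂_whisker_right := fun _ _ => PlainCatOperad.Algebra.WeakHom.Trans.ext' fun _ =>
        PlainCatOperad.Algebra.WeakHom.conj_id rfl rfl _ }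

/-- Equivariance of `A` forces its value on `(σ, p)`, because this pair is `σ` acting on `(1, p)`.
-/
theorem toPlain_freeSym_obj (A : Algebra.{u, v, w, z} (freeSymCat Q)) {n : ℕ}
    (f : (freeSymCat Q).Op n) (a : Fin n → A.carrier) :
    A.toPlain.freeSym.obj f a = A.obj f a :=
  (A.obj_act f.1 (freeSymCatUnit f.2) a).symm

theorem toPlain_freeSym_map (A : Algebra.{u, v, w, z} (freeSymCat Q)) {n : ℕ}
    {f f' : (freeSymCat Q).Op n} {a a' : Fin n → A.carrier} (α : f ⟶ f')
    (x : ∀ i, a i ⟶ a' i) : HEq (A.toPlain.freeSym.map α x) (A.map α x) := by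
  obtain ⟨σ, f⟩ := f
  obtain ⟨_, f'⟩ := f'
  obtain ⟨h₁, α⟩ := α
  cases h₁
  exact (A.map_actMap σ (freeSymCatUnitHom α) x).symm

end SymCatOperad.Algebra
end

/-! ### Strict morphisms and the comparison with the underlying plain algebra -/

theorem eqToHom_heq_eqToHom {C : Type u} [Category.{v} C] {a b a' b' : C} (ha : a = a')
    (h : a = b) (h' : a' = b') : HEq (eqToHom h) (eqToHom h') := by
  subst ha h h'
  rfl

section

variable {Q : PlainCatOperad.{u, v}}

theorem PlainCatOperad.Algebra.map_eqToHom (A : PlainCatOperad.Algebra.{u, v, w, z} Q) {n : ℕ}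
    (f : Q.Op n) {a a' : Fin n → A.carrier} (h : ∀ i, a i = a' i) :
    A.map (𝟙 f) (fun i => eqToHom (h i)) = eqToHom (congrArg (A.obj f) (funext h)) := by
  obtain rfl : a = a' := funext h
  exact A.map_id f a

end

namespace SymCatOperad.Algebra

/-- A strict morphism of algebras, regarded as a weak morphism. -/
def WeakHom.ofStrict {R : SymCatOperad.{u, v}} {A B : Algebra.{u, v, w, z} R}
    (I : A.carrier ⥤ B.carrier)
    (hobj : ∀ {n : ℕ} (f : R.Op n) (a : Fin n → A.carrier),
      B.obj f (fun i => I.obj (a i)) = I.obj (A.obj f a))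
    (hmap : ∀ {n : ℕ} {f f' : R.Op n} {a a' : Fin n → A.carrier} (α : f ⟶ f')
      (x : ∀ i, a i ⟶ a' i), HEq (B.map α fun i => I.map (x i)) (I.map (A.map α x))) :
    WeakHom A B where
  functor := I
  coh f a := eqToIso (hobj f a)
  -- Composing with `eqToHom` does not change a morphism up to heterogeneous equality, which leaves
  -- exactly `hmap`.
  naturality {n f f' a a'} α x := eq_of_heq ((comp_eqToHom_heq _ (hobj f' a')).trans
    ((hmap α x).trans (eqToHom_comp_heq _ (hobj f a)).symm))
  coh_one a := eqToHom_heq_eqToHom (B.obj_one _) (hobj _ a) rfl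
  coh_comp {n m k} f g h a := by
    have h1 : ∀ i, B.obj (g i) (fun j => I.obj (a (blockEquiv k h ⟨i, j⟩))) =
        I.obj (A.obj (g i) fun j => a (blockEquiv k h ⟨i, j⟩)) := fun i => hobj (g i) _
    have h2 := hobj f fun i => A.obj (g i) fun j => a (blockEquiv k h ⟨i, j⟩)
    have h3 : B.map (𝟙 f) (fun i => eqToHom (h1 i)) ≫ eqToHom h2 =
        eqToHom ((congrArg (B.obj f) (funext h1)).trans h2) := by
      rw [B.map_eqToHom f h1, eqToHom_trans]
    exact (eqToHom_heq_eqToHom (B.obj_opComp f g h _) (hobj _ a) _).trans (heq_of_eq h3.symm)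
  coh_act σ f a := eqToHom_heq_eqToHom (B.obj_act σ f _) (hobj _ a) (hobj f _)

variable {Q : PlainCatOperad.{u, v}}

/-- The comparison of the algebra generated by the underlying algebra for `Q` with the algebra. -/
def freeSymToPlainHom (A : Algebra.{u, v, w, z} (freeSymCat Q)) : WeakHom A.toPlain.freeSym A :=
  WeakHom.ofStrict (A := A.toPlain.freeSym) (𝟭 A.carrier)
    (fun f a => (toPlain_freeSym_obj A f a).symm)
    (fun α x => (toPlain_freeSym_map A α x).symm)

/-- The comparison of an algebra with the one generated by the underlying algebra for `Q`. -/
def freeSymToPlainInv (A : Algebra.{u, v, w, z} (freeSymCat Q)) : WeakHom A A.toPlain.freeSym :=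
  WeakHom.ofStrict (B := A.toPlain.freeSym) (𝟭 A.carrier)
    (fun f a => toPlain_freeSym_obj A f a)
    (fun α x => toPlain_freeSym_map A α x)

theorem freeSymToPlain_hom_inv (A : Algebra.{u, v, w, z} (freeSymCat Q)) :
    (freeSymToPlainHom A).comp (freeSymToPlainInv A) = WeakHom.id A.toPlain.freeSym :=
  WeakHom.eq_of_coh rfl fun f a => heq_of_eq
    ((congrArg (fun y => eqToHom (toPlain_freeSym_obj A f a) ≫ y) (eqToHom_map (𝟭 A.carrier)
      (toPlain_freeSym_obj A f a).symm)).trans (eqToHom_trans _ _))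

theorem freeSymToPlain_inv_hom (A : Algebra.{u, v, w, z} (freeSymCat Q)) :
    (freeSymToPlainInv A).comp (freeSymToPlainHom A) = WeakHom.id A :=
  WeakHom.eq_of_coh rfl fun f a => heq_of_eq
    ((congrArg (fun y => eqToHom (toPlain_freeSym_obj A f a).symm ≫ y) (eqToHom_map (𝟭 A.carrier)
      (toPlain_freeSym_obj A f a))).trans (eqToHom_trans _ _))

/-- An algebra is isomorphic to the one generated by the underlying algebra for `Q`. -/
def freeSymToPlainIso (A : Algebra.{u, v, w, z} (freeSymCat Q)) : A.toPlain.freeSym ≅ A where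
  hom := freeSymToPlainHom A
  inv := freeSymToPlainInv A
  hom_inv_id := freeSymToPlain_hom_inv A
  inv_hom_id := freeSymToPlain_inv_hom A

/-- The comparison has only `eqToHom` as coherence maps, so everything reduces to `coh_act`: the
coherence map of `F` at `(σ, p)` is the one at `(1, p)` on permuted arguments. -/
theorem freeSymToPlainHom_naturality {A B : Algebra.{u, v, w, z} (freeSymCat Q)}
    (F : WeakHom A B) :
    F.toPlain.freeSym.comp (freeSymToPlainHom B) = (freeSymToPlainHom A).comp F :=
  WeakHom.eq_of_coh rfl fun {n} f a => by
    have h1 : HEq (F.toPlain.freeSym.coh f a).hom (F.coh f a).hom :=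
      (F.coh_act f.1 (freeSymCatUnit f.2) a).symm
    have h2 : F.functor.map (eqToHom (toPlain_freeSym_obj A f a).symm) = eqToHom _ :=
      eqToHom_map _ _
    have h3 : HEq ((F.coh f a).hom ≫ F.functor.map (eqToHom (toPlain_freeSym_obj A f a).symm))
        (F.coh f a).hom := by
      rw [h2]
      exact comp_eqToHom_heq _ _
    exact (eqToHom_comp_heq (F.toPlain.freeSym.coh f a).hom
      (toPlain_freeSym_obj B f fun i => F.functor.obj (a i)).symm).trans (h1.trans h3.symm)

/-- Algebras for the free symmetric `Cat`-operad on `Q` are equivalent to algebras for `Q`. -/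
def freeSymEquivalence (Q : PlainCatOperad.{u, v}) :
    TwoEquivalence (PlainCatOperad.Algebra.{u, v, w, z} Q)
      (Algebra.{u, v, w, z} (freeSymCat Q)) where
  functor := PlainCatOperad.Algebra.freeSymFunctor Q
  inverse := toPlainFunctor Q
  -- Going to the free symmetric operad and back only uses the identity permutation, so it returns
  -- `A` definitionally.
  unitIso := NatIso.ofComponents (fun A => Iso.refl A)
    (fun F => (Category.comp_id F).trans (Category.id_comp F).symm)
  counitIso := NatIso.ofComponents (fun A => freeSymToPlainIso A)
    (fun F => freeSymToPlainHom_naturality F)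
  unit_naturality {A B F G} η := PlainCatOperad.Algebra.WeakHom.Trans.heq_of_app
    ((Category.comp_id F).trans (Category.id_comp F).symm)
    ((Category.comp_id G).trans (Category.id_comp G).symm) fun _ => HEq.rfl
  counit_naturality {A B F G} η := WeakHom.trans_heq_of_app
    (freeSymToPlainHom_naturality F) (freeSymToPlainHom_naturality G) fun _ => HEq.rfl

end SymCatOperad.Algebra

/-! ## Composition of equivalences of strict `2`-categories -/

namespace CategoryTheory

open CategoryTheory.Bicategory

section

variable {B : Type*} [Bicategory B] [Bicategory.Strict B]

theorem Bicategory.whiskerLeft_heq {a b c : B} (u : a ⟶ b) {f g f' g' : b ⟶ c} (hf : f = f')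
    (hg : g = g') {η : f ⟶ g} {η' : f' ⟶ g'} (h : HEq η η') : HEq (u ◁ η) (u ◁ η') := by
  subst hf hg h
  rfl

theorem Bicategory.whiskerRight_heq {a b c : B} {f g f' g' : a ⟶ b} (hf : f = f')
    (hg : g = g') {η : f ⟶ g} {η' : f' ⟶ g'} (h : HEq η η') (u : b ⟶ c) :
    HEq (η ▷ u) (η' ▷ u) := by
  subst hf hg h
  rfl

theorem Bicategory.eqToHom_conj_heq {a b : B} {f g f' g' : a ⟶ b} (hf : f' = f) (hg : g = g')
    (η : f ⟶ g) : HEq (eqToHom hf ≫ η ≫ eqToHom hg) η := by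
  subst hf hg
  simp

/-- In a strict bicategory the associators are `eqToHom`, and conjugating by them is invisible to
heterogeneous equality. The same reason gives the next two laws. -/
theorem Bicategory.Strict.whiskerRight_comp_heq {a b c d : B} {f g : a ⟶ b} (η : f ⟶ g)
    (u : b ⟶ c) (v : c ⟶ d) : HEq (η ▷ (u ≫ v)) (η ▷ u ▷ v) := by
  rw [Bicategory.whiskerRight_comp, Bicategory.Strict.associator_eqToIso,
    Bicategory.Strict.associator_eqToIso]
  simp only [eqToIso.hom, eqToIso.inv]
  exact Bicategory.eqToHom_conj_heq _ _ _

theorem Bicategory.Strict.comp_whiskerLeft_heq {a b c d : B} (u : a ⟶ b) (v : b ⟶ c)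
    {f g : c ⟶ d} (η : f ⟶ g) : HEq ((u ≫ v) ◁ η) (u ◁ v ◁ η) := by
  rw [Bicategory.comp_whiskerLeft, Bicategory.Strict.associator_eqToIso,
    Bicategory.Strict.associator_eqToIso]
  simp only [eqToIso.hom, eqToIso.inv]
  exact Bicategory.eqToHom_conj_heq _ _ _

theorem Bicategory.Strict.whisker_assoc_heq {a b c d : B} (u : a ⟶ b) {f g : b ⟶ c} (η : f ⟶ g)
    (v : c ⟶ d) : HEq ((u ◁ η) ▷ v) (u ◁ η ▷ v) := by
  rw [Bicategory.whisker_assoc, Bicategory.Strict.associator_eqToIso,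
    Bicategory.Strict.associator_eqToIso]
  simp only [eqToIso.hom, eqToIso.inv]
  exact Bicategory.eqToHom_conj_heq _ _ _

end

end CategoryTheory

section

open Bicategory

theorem CategoryTheory.StrictPseudofunctor.map₂_heq {B : Type*} [Bicategory B] {C : Type*}
    [Bicategory C] (F : StrictPseudofunctor B C) {a b : B}
    {f g f' g' : a ⟶ b} (hf : f = f') (hg : g = g') {η : f ⟶ g} {η' : f' ⟶ g'} (h : HEq η η') :
    HEq (F.map₂ η) (F.map₂ η') := by
  subst hf hg h
  rfl

variable {B : Type*} [Bicategory B] [Bicategory.Strict B] {C : Type*} [Bicategory C]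
  [Bicategory.Strict C] {D : Type*} [Bicategory D] [Bicategory.Strict D]

/-- The composition constraints of a strict pseudofunctor are `eqToHom`, so they disappear up to
heterogeneous equality. -/
theorem CategoryTheory.StrictPseudofunctor.map₂_whiskerLeft_heq (F : StrictPseudofunctor B C)
    {a b c : B} (u : a ⟶ b) {f g : b ⟶ c} (η : f ⟶ g) :
    HEq (F.map₂ (u ◁ η)) (F.map u ◁ F.map₂ η) := by
  rw [F.map₂_whisker_left, F.mapComp_eq_eqToIso, F.mapComp_eq_eqToIso]
  simp only [eqToIso.hom, eqToIso.inv]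
  exact Bicategory.eqToHom_conj_heq _ _ _

theorem CategoryTheory.StrictPseudofunctor.map₂_whiskerRight_heq (F : StrictPseudofunctor B C)
    {a b c : B} {f g : a ⟶ b} (η : f ⟶ g) (u : b ⟶ c) :
    HEq (F.map₂ (η ▷ u)) (F.map₂ η ▷ F.map u) := by
  rw [F.map₂_whisker_right, F.mapComp_eq_eqToIso, F.mapComp_eq_eqToIso]
  simp only [eqToIso.hom, eqToIso.inv]
  exact Bicategory.eqToHom_conj_heq _ _ _


/-- Pasting of two squares: the one of `E.unitIso` at `η`, and the image under `E.inverse` of the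
one of `E'.unitIso` at `E.functor.map₂ η`. -/
theorem TwoEquivalence.unit_naturality_trans (E : TwoEquivalence B C) (E' : TwoEquivalence C D)
    {a b : B} {f g : a ⟶ b} (η : f ⟶ g) :
    HEq (η ▷ (E.unitIso.hom.app b ≫ E.inverse.map (E'.unitIso.hom.app (E.functor.obj b))))
      ((E.unitIso.hom.app a ≫ E.inverse.map (E'.unitIso.hom.app (E.functor.obj a))) ◁
        E.inverse.map₂ (E'.inverse.map₂ (E'.functor.map₂ (E.functor.map₂ η)))) := by
  -- The 1-dimensional naturality equations identify the boundaries of the 2-cells, as each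
  -- heterogeneous rewriting step requires.
  have n1 := fun k : a ⟶ b => E.unitIso.hom.naturality k
  have n2 := fun k : a ⟶ b => E'.unitIso.hom.naturality (E.functor.map k)
  have n3 := fun k : a ⟶ b => (E.inverse.map_comp _ _).symm.trans
    ((congrArg (fun y => E.inverse.map y) (n2 k)).trans (E.inverse.map_comp _ _))
  refine (Bicategory.Strict.whiskerRight_comp_heq _ _ _).trans ?_
  refine (Bicategory.whiskerRight_heq (n1 f) (n1 g) (E.unit_naturality η) _).trans ?_
  refine (Bicategory.Strict.whisker_assoc_heq _ _ _).trans ?_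
  refine (Bicategory.whiskerLeft_heq _ (n3 f) (n3 g) ?_).trans
    (Bicategory.Strict.comp_whiskerLeft_heq _ _ _).symm
  refine (E.inverse.map₂_whiskerRight_heq _ _).symm.trans ?_
  refine (E.inverse.map₂_heq (n2 f) (n2 g) (E'.unit_naturality (E.functor.map₂ η))).trans ?_
  exact E.inverse.map₂_whiskerLeft_heq _ _

/-- Pasting in the opposite order: the image under `E'.functor` of the square of `E.counitIso` at
`E'.inverse.map₂ η`, then the square of `E'.counitIso` at `η`. -/
theorem TwoEquivalence.counit_naturality_trans (E : TwoEquivalence B C) (E' : TwoEquivalence C D)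
    {a b : D} {f g : a ⟶ b} (η : f ⟶ g) :
    HEq (E'.functor.map₂ (E.functor.map₂ (E.inverse.map₂ (E'.inverse.map₂ η))) ▷
        (E'.functor.map (E.counitIso.hom.app (E'.inverse.obj b)) ≫ E'.counitIso.hom.app b))
      ((E'.functor.map (E.counitIso.hom.app (E'.inverse.obj a)) ≫ E'.counitIso.hom.app a) ◁
        η) := by
  have n1 := fun k : a ⟶ b => E'.counitIso.hom.naturality k
  have n2 := fun k : a ⟶ b => E.counitIso.hom.naturality (E'.inverse.map k)
  have n3 := fun k : a ⟶ b => (E'.functor.map_comp _ _).symm.trans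
    ((congrArg (fun y => E'.functor.map y) (n2 k)).trans (E'.functor.map_comp _ _))
  refine (Bicategory.Strict.whiskerRight_comp_heq _ _ _).trans ?_
  refine (Bicategory.whiskerRight_heq (n3 f) (n3 g) ?_ _).trans
    ((Bicategory.Strict.whisker_assoc_heq _ (E'.functor.map₂ (E'.inverse.map₂ η)) _).trans ?_)
  · refine (E'.functor.map₂_whiskerRight_heq _ _).symm.trans ?_
    refine (E'.functor.map₂_heq (n2 f) (n2 g) (E.counit_naturality (E'.inverse.map₂ η))).trans ?_
    exact E'.functor.map₂_whiskerLeft_heq _ _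
  · exact (Bicategory.whiskerLeft_heq _ (n1 f) (n1 g) (E'.counit_naturality η)).trans
      (Bicategory.Strict.comp_whiskerLeft_heq _ _ _).symm

/-- Composition of equivalences of strict `2`-categories. -/
def TwoEquivalence.trans (E : TwoEquivalence B C) (E' : TwoEquivalence C D) :
    TwoEquivalence B D where
  functor := E.functor.comp E'.functor
  inverse := E'.inverse.comp E.inverse
  unitIso := NatIso.ofComponents
    -- The components are spelled out to match `unit_naturality_trans`; their naturality is
    -- inherited from the whiskered composite of natural isomorphisms.
    (fun a => E.unitIso.app a ≪≫
      E.inverse.toFunctor.mapIso (E'.unitIso.app (E.functor.obj a)))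
    (fun f => (E.unitIso ≪≫ Functor.isoWhiskerRight
      (Functor.isoWhiskerLeft E.functor.toFunctor E'.unitIso) E.inverse.toFunctor).hom.naturality f)
  counitIso := NatIso.ofComponents
    (fun a => E'.functor.toFunctor.mapIso (E.counitIso.app (E'.inverse.obj a)) ≪≫
      E'.counitIso.app a)
    (fun f => (Functor.isoWhiskerRight (Functor.isoWhiskerLeft E'.inverse.toFunctor E.counitIso)
      E'.functor.toFunctor ≪≫ E'.counitIso).hom.naturality f)
  unit_naturality η := E.unit_naturality_trans E' η
  counit_naturality η := E.counit_naturality_trans E' η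

end

theorem mainTheorem8 :
    (∀ P : PlainOperad.{u},
      Nonempty (Bicategory.Equivalence (freeSymCat P.Wk) (freeSym P).Wk)) ∧
    (∃ P : PlainOperad.{u}, IsEmpty (freeSymCat P.Wk ≅ (freeSym P).Wk)) ∧
    (∀ P : PlainOperad.{u},
      Nonempty (TwoEquivalence (PlainOperad.WkCat.{u, w, z} P)
        (SymOperad.WkCat.{u, w, z} (freeSym P)))) :=
  ⟨fun P => ⟨wkEquivalence P⟩, ⟨terminalPlainOperad, isEmpty_iso_wk_terminal⟩, fun P =>
    -- Algebras for `freeSymCat P.Wk` mediate between the two sides: the first factor passes from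
    -- plain to symmetric operads, the second changes the symmetric `Cat`-operad along the
    -- equivalence of the first claim.
    ⟨(SymCatOperad.Algebra.freeSymEquivalence P.Wk).trans
      (SymCatOperad.Algebra.restrictEquivalence (wkEquivalence P))⟩⟩
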